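/- Let $M$ be a smooth (Hausdorff, paracompact) $d$-dimensional manifold, $\Omega\subset M$ an open subset and $k\ge 0$ an integer. For a manifold $N$, $C^\infty(N)$ denotes the space of smooth real-valued functions on $N$, with the topology of uniform convergence of all derivatives, in charts, on compact subsets. A map $f:E\to G$ between Hausdorff locally convex spaces is Bastiani smooth if for every $n\ge 0$ the differential $$D^nf_x(v_1,\dots,v_n)=\frac{\partial^n f(x+t_1v_1+\dots+t_nv_n)}{\partial t_1\cdots\partial t_n}\Big|_{t=0}$$ exists for all $x,v_1,\dots,v_n\in E$ and $D^nf:E\times E^n\to G$ is continuous. For $x\in\Omega$ let $I_x\subset C^\infty(\Omega)$ be the ideal of functions vanishing at $x$, let $J^p_x\Omega=C^\infty(\Omega)/I_x^{p+1}$ be the space of $p$-jets at $x$, $j^p\psi_x$ the class of $\psi$, and $J^p\Omega$ the bundle of $p$-jets. Let $D_k\subset\Omega^k$ be the set of $k$-tuples with two equal entries, and let $J^p\Omega^{\boxtimes k}|_{\Omega^k\setminus D_k}$ be the bundle over $\Omega^k\setminus D_k$ with fibre $J^p_{x_1}\Omega\times\dots\times J^p_{x_k}\Omega$ over $(x_1,\dots,x_k)$.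 1. (Second Peetre theorem.) Let $F:C^\infty(\Omega)\to C^\infty(\Omega^k)$ be Bastiani smooth and $k$-local: for every $(x_1,\dots,x_k)\in\Omega^k$, if $\varphi_1=\varphi_2$ on a neighbourhood of $\{x_1,\dots,x_k\}$, then $F(\varphi_1)(x_1,\dots,x_k)=F(\varphi_2)(x_1,\dots,x_k)$. Then for every $\varphi\in C^\infty(\Omega)$ and every compact set $K\subset\Omega^k$ there are a neighbourhood $V$ of $\varphi$ in $C^\infty(\Omega)$, an integer $p\ge 0$ and a smooth function $c$ on $J^p\Omega^{\boxtimes k}|_{\Omega^k\setminus D_k}$ such that $$F(\varphi+\psi)(x_1,\dots,x_k)=c(j^p\psi_{x_1},\dots,j^p\psi_{x_k})$$ for all $\psi$ with $\varphi+\psi\in V$ and all $(x_1,\dots,x_k)\in K\setminus D_k$. 2. (Peetre theorem for local functionals.) Let $F:C^\infty(\Omega)\to C^\infty(\Omega)$ be Bastiani smooth and Peetre local: for every $x\in\Omega$, if $\varphi_1=\varphi_2$ on a neighbourhood of $x$, then $F(\varphi_1)(x)=F(\varphi_2)(x)$. Then for every $\varphi\in C^\infty(\Omega)$ and every compact set $K\subset\Omega$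 there are a neighbourhood $V$ of $\varphi$, an integer $p\ge 0$ and a smooth function $c$ on $J^p\Omega$ such that $F(\varphi+\psi)(x)=c(j^p\psi_x)$ for all $\psi$ with $\varphi+\psi\in V$ and all $x\in K$. (If $\Omega$ is compact, one may take $K=\Omega^k$, respectively $K=\Omega$, and the identities hold at all points.) -/

import Mathlib

open Set Filter Topology Manifold
open scoped ContDiff

noncomputable section

namespace Peetre

section Bastiani

variable {E F : Type*} [AddCommGroup E] [Module ℝ E] [TopologicalSpace E]
  [AddCommGroup F] [Module ℝ F] [TopologicalSpace F]

/-- `f` has the derivative `y` at `x` in the direction `v`: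
`y = lim_{t → 0} (f (x + t v) - f x) / t`. -/
def HasGateauxDeriv (f : E → F) (x v : E) (y : F) : Prop :=
  Tendsto (fun t : ℝ => t⁻¹ • (f (x + t • v) - f x)) (𝓝[≠] 0) (𝓝 y)

/-- `f : E → F` is Bastiani smooth: for every `n` the `n`-th Gateaux differential
`D n x (v₀, …, vₙ₋₁) = ∂ⁿ f (x + t₀ v₀ + ⋯ + tₙ₋₁ vₙ₋₁) / ∂t₀ ⋯ ∂tₙ₋₁ |_{t = 0}`
exists at all points and in all directions, and `D n : E × Eⁿ → F` is (jointly) continuous.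
The mixed partial derivative is taken one variable at a time. -/
def IsBastianiSmooth (f : E → F) : Prop :=
  ∃ D : (n : ℕ) → E → (Fin n → E) → F,
    (∀ x v, D 0 x v = f x) ∧
    (∀ n x (v : Fin n → E) (w : E),
      HasGateauxDeriv (fun z => D n z v) x w (D (n + 1) x (Fin.cons w v))) ∧
    ∀ n, Continuous fun q : E × (Fin n → E) => D n q.1 q.2

end Bastiani

section Spaces

variable {E : Type*} [NormedAddCommGroup E] [NormedSpace ℝ E] {H : Type*} [TopologicalSpace H]
  (I : ModelWithCorners ℝ E H) (N : Type*) [TopologicalSpace N] [ChartedSpace H N]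

/-- The space `C^∞(N)` of smooth real-valued functions on the manifold `N`. -/
abbrev SmoothFun : Type _ := C^∞⟮I, N; 𝓘(ℝ, ℝ), ℝ⟯

variable {I N}

/-- The `m`-th derivative of a function on `N`, read in the chart `e`. -/
def chartDeriv (e : OpenPartialHomeomorph N H) (m : ℕ) (f : SmoothFun I N) :
    E → E [×m]→L[ℝ] ℝ :=
  iteratedFDeriv ℝ m (f ∘ (e.extend I).symm)

/-- The topology of `C^∞(N)`: uniform convergence of all derivatives, read in the charts of the
atlas, on the compact subsets of (the images of) the charts. It is the coarsest topology for which
all the maps `f ↦ f ∘ e⁻¹`, with `e` a chart, are continuous into the space of smooth functions on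
the image of `e` with its usual seminorms. -/
instance smoothFunTopology : TopologicalSpace (SmoothFun I N) :=
  ⨅ e ∈ atlas H N, ⨅ m : ℕ,
    TopologicalSpace.induced
      (fun f : SmoothFun I N =>
        UniformOnFun.ofFun {K : Set E | IsCompact K ∧ K ⊆ (e.extend I).target}
          (chartDeriv e m f))
      inferInstance

variable (I N)

/-- The space `C^∞(Nᵏ)`. -/
abbrev SmoothFunPow (k : ℕ) : Type _ :=
  SmoothFun (ModelWithCorners.pi fun _ : Fin k => I) (Fin k → N)

variable {I N}

/-- `F : C^∞(N) → C^∞(N)` is Peetre local: `F φ x` depends only on the germ of `φ` at `x`. -/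
def IsPeetreLocal (F : SmoothFun I N → SmoothFun I N) : Prop :=
  ∀ (x : N) (φ₁ φ₂ : SmoothFun I N), (∀ᶠ y in 𝓝 x, φ₁ y = φ₂ y) → F φ₁ x = F φ₂ x

/-- `F : C^∞(N) → C^∞(Nᵏ)` is `k`-local: if `φ₁ = φ₂` on a neighbourhood of `{x₁, …, x_k}`, then
`F φ₁ (x₁, …, x_k) = F φ₂ (x₁, …, x_k)`. -/
def IsMultilocal {k : ℕ} (F : SmoothFun I N → SmoothFunPow I N k) : Prop :=
  ∀ (x : Fin k → N) (φ₁ φ₂ : SmoothFun I N),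
    (∀ᶠ y in 𝓝ˢ (Set.range x), φ₁ y = φ₂ y) → F φ₁ x = F φ₂ x

variable (I)

/-- The ideal of the smooth functions that vanish at `x`. -/
def vanishingIdeal (x : N) : Ideal (SmoothFun I N) :=
  RingHom.ker (ContMDiffMap.evalRingHom x : SmoothFun I N →+* ℝ)

/-- The space `J^p_x(N) = C^∞(N) / I_x^{p+1}` of `p`-jets at `x`. -/
abbrev JetSpace (p : ℕ) (x : N) : Type _ :=
  SmoothFun I N ⧸ vanishingIdeal I x ^ (p + 1)

variable {I}

/-- The `p`-jet of `ψ` at `x`. -/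
def jet (p : ℕ) (x : N) (ψ : SmoothFun I N) : JetSpace I p x :=
  Ideal.Quotient.mk (vanishingIdeal I x ^ (p + 1)) ψ

variable (N)

/-- `Nᵏ` minus all diagonals: the `k`-tuples of pairwise distinct points. -/
abbrev ConfigSpace (k : ℕ) : Type _ := {x : Fin k → N // Function.Injective x}

variable (I)

/-- (The total space of) the bundle `J^p(N)` of `p`-jets. -/
abbrev JetBundle (p : ℕ) : Type _ := Σ x : N, JetSpace I p x

/-- (The total space of) the bundle over `Nᵏ` minus all diagonals with fibre
`J^p_{x₁}(N) × ⋯ × J^p_{x_k}(N)` over `(x₁, …, x_k)`. -/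
abbrev MultiJetBundle (p k : ℕ) : Type _ :=
  Σ x : ConfigSpace N k, ∀ i, JetSpace I p (x.1 i)

variable (E) in
/-- The derivatives of orders `0, …, p` of a function on `E` at a point. -/
abbrev JetCoeff (p : ℕ) : Type _ := (j : Fin (p + 1)) → E [×(j : ℕ)]→L[ℝ] ℝ

variable {I N}

/-- The fibre coordinates, in the chart `e`, of the `p`-jet of `ψ` at `x`. -/
def jetCoord (e : OpenPartialHomeomorph N H) (p : ℕ) (x : N) (ψ : SmoothFun I N) :
    JetCoeff E p :=
  fun j => chartDeriv e j ψ (e.extend I x)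

/-- Smooth functions on the jet bundle `J^p(N)`: in the coordinates `(x, (∂^α ψ(x))_{|α| ≤ p})`
that every chart of `N` induces on the jet bundle, `c` is a smooth function. -/
def IsSmoothOnJets {p : ℕ} (c : JetBundle I N p → ℝ) : Prop :=
  ∀ e ∈ atlas H N, ∃ g : E × JetCoeff E p → ℝ,
    ContDiffOn ℝ ∞ g {q | q.1 ∈ (e.extend I).target} ∧
    ∀ x ∈ e.source, ∀ ψ : SmoothFun I N,
      c ⟨x, jet p x ψ⟩ = g (e.extend I x, jetCoord e p x ψ)

/-- Smooth functions on the multi-jet bundle over `Nᵏ` minus all diagonals: in the coordinates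
`(x₁, …, x_k, (∂^α ψ₁(x₁))_{|α| ≤ p}, …, (∂^α ψ_k(x_k))_{|α| ≤ p})` that every `k`-tuple of charts
of `N` induces on it, `c` is a smooth function. -/
def IsSmoothOnMultiJets {p k : ℕ} (c : MultiJetBundle I N p k → ℝ) : Prop :=
  ∀ e : Fin k → OpenPartialHomeomorph N H, (∀ i, e i ∈ atlas H N) →
    ∃ g : (Fin k → E) × (Fin k → JetCoeff E p) → ℝ,
      ContDiffOn ℝ ∞ g {q | (∀ i, q.1 i ∈ ((e i).extend I).target) ∧
        Function.Injective fun i => ((e i).extend I).symm (q.1 i)} ∧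
      ∀ x : ConfigSpace N k, (∀ i, x.1 i ∈ (e i).source) → ∀ ψ : Fin k → SmoothFun I N,
        c ⟨x, fun i => jet p (x.1 i) (ψ i)⟩ =
          g (fun i => (e i).extend I (x.1 i), fun i => jetCoord (e i) p (x.1 i) (ψ i))

end Spaces

end Peetre

end

/-! Finite order (`exists_order`). The differential `DF` is jointly continuous and `DF_φ(0) = 0`, so
for a compact `K` there are an order `p`, a neighbourhood of `φ` and a `C^p`-small ball around `0`
such that `|DF_z(v)(x)| < 1` for `z` in the first, `v` in the second and `x ∈ K`. If the `p`-jets of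
`v` vanish at the distinct points `x_i`, Taylor's formula allows `v` to be cut off near these points
to a function with the same germs and arbitrarily small `C^p` size (`exists_cutoff_of_flat`).
Locality keeps `DF_z(v)(x)` unchanged, and homogeneity in `v` then forces it to be `0`. Integrating
along the segment from `f` to `g` gives `F f x = F g x` whenever `f` and `g` are near `φ` and have
the same `p`-jets at the `x_i`.

Smoothness (`exists_local_jet_function`). Jets at points near a given tuple are realized by a
finite-dimensional family of functions whose parameters depend smoothly on the points and the jets
(`exists_multijet_family`). A Bastiani smooth map restricted to such a family is smooth in the
parameters and the point together (`IsBastianiSmooth.contDiffOn_family`). Hence `F` evaluated on the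
realizing function is a smooth function of the jet. The realizing function has to stay in the
neighbourhood where the order is `p`: it is taken as an admissible `ψ₁` plus a small correction, and
control of one more derivative, of order `p + 1`, keeps the correction small near the given point.

Gluing (`exists_multiJet_function`). In coordinates, taking the value imposed by `F` is a convex
condition, so the local solutions are patched by a partition of unity on the jet domain. Finitely
many chart cutoffs then assemble the coordinate functions into one function on the bundle. The local
theorem is the case `k = 1`, through the identification of `N` with `N¹`. -/

noncomputable section

namespace Peetre

/-! ### Calculus in finite dimension: smoothness from line derivatives, and cutoffs of flat
functions. -/

section Analysis

/-- A function with continuous line derivatives in the directions of a basis is differentiable. -/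
theorem hasFDerivAt_of_basis_lineDeriv {W ι : Type*} [NormedAddCommGroup W] [NormedSpace ℝ W]
    [FiniteDimensional ℝ W] [Fintype ι] (b : Module.Basis ι ℝ W) {f : W → ℝ} {g : ι → W → ℝ}
    {U : Set W} {x : W} (hU : U ∈ 𝓝 x)
    (hd : ∀ i, ∀ z ∈ U, HasLineDerivAt ℝ f (g i z) z (b i))
    (hg : ∀ i, ContinuousAt (g i) x) :
    HasFDerivAt f (∑ i, g i x • (b.coord i).toContinuousLinearMap) x := by
  classical
  have hcont : ∀ i, Continuous fun h : W => b.repr h i := fun i =>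
    (b.coord i).continuous_of_finiteDimensional
  -- The increment is built one coordinate at a time; each new coordinate costs `o(h)` by the mean
  -- value inequality along the line in the direction `b i`.
  have key : ∀ S : Finset ι,
      (fun h : W => f (x + ∑ j ∈ S, b.repr h j • b j) - f x - ∑ j ∈ S, b.repr h j * g j x)
        =o[𝓝 0] fun h => h := by
    intro S
    induction S using Finset.induction_on with
    | empty => simp
    | insert i S hi ih =>
      have step : (fun h : W => f (x + ∑ j ∈ S, b.repr h j • b j + b.repr h i • b i)
          - f (x + ∑ j ∈ S, b.repr h j • b j) - b.repr h i * g i x) =o[𝓝 0] fun h => h := by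
        have hO : (fun h : W => b.repr h i) =O[𝓝 0] fun h => h :=
          ((b.coord i).toContinuousLinearMap).isBigO_id _
        refine Asymptotics.IsLittleO.trans_isBigO ?_ hO
        rw [Asymptotics.isLittleO_iff]
        intro ε hε
        obtain ⟨δ, hδ, hball⟩ := Metric.mem_nhds_iff.1 (Filter.inter_mem hU
          ((hg i).preimage_mem_nhds (Metric.closedBall_mem_nhds (g i x) hε)))
        have ht : Tendsto (fun h : W => ‖∑ j ∈ S, b.repr h j • b j‖ + |b.repr h i| * ‖b i‖)
            (𝓝 0) (𝓝 0) := by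
          have : Continuous fun h : W => ‖∑ j ∈ S, b.repr h j • b j‖ + |b.repr h i| * ‖b i‖ := by
            have := hcont i
            fun_prop
          simpa using this.tendsto 0
        filter_upwards [ht.eventually (gt_mem_nhds hδ)] with h hh
        set z := x + ∑ j ∈ S, b.repr h j • b j with hz
        have hmem : ∀ t ∈ uIcc 0 (b.repr h i), z + t • b i ∈ Metric.ball x δ := by
          intro t ht
          rw [Metric.mem_ball, dist_eq_norm]
          have h1 : |t| ≤ |b.repr h i| := by
            have := abs_sub_left_of_mem_uIcc ht
            simpa using this
          calc ‖z + t • b i - x‖ = ‖∑ j ∈ S, b.repr h j • b j + t • b i‖ := by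
                rw [hz]; congr 1; abel
            _ ≤ ‖∑ j ∈ S, b.repr h j • b j‖ + |t| * ‖b i‖ := by
                refine (norm_add_le _ _).trans ?_
                rw [norm_smul, Real.norm_eq_abs]
            _ ≤ _ := by gcongr
            _ < δ := hh
        have hder : ∀ t ∈ uIcc 0 (b.repr h i),
            HasDerivWithinAt (fun t : ℝ => f (z + t • b i) - t * g i x)
              (g i (z + t • b i) - g i x) (uIcc 0 (b.repr h i)) t := by
          intro t ht
          have h1 := hd i _ (hball (hmem t ht)).1
          have h2 : HasDerivAt (fun t : ℝ => f (z + t • b i)) (g i (z + t • b i)) t := by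
            have h3 : HasDerivAt (fun r : ℝ => f (z + t • b i + r • b i))
              (g i (z + t • b i)) (t - t) := by rw [sub_self]; exact h1
            have h4 := HasDerivAt.comp_sub_const t t h3
            refine h4.congr_of_eventuallyEq (Eventually.of_forall fun r => ?_)
            simp only [sub_smul]
            congr 1
            abel
          have h5 := (h2.sub ((hasDerivAt_id t).mul_const (g i x))).hasDerivWithinAt
            (s := uIcc 0 (b.repr h i))
          rw [one_mul] at h5
          exact h5
        have := (convex_uIcc (0 : ℝ) (b.repr h i)).norm_image_sub_le_of_norm_hasDerivWithin_le
          (C := ε) hder (fun t ht => by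
            have := (hball (hmem t ht)).2
            rwa [mem_preimage, mem_closedBall_iff_norm] at this) left_mem_uIcc right_mem_uIcc
        simp only [zero_smul, add_zero, zero_mul, sub_zero] at this
        rwa [sub_right_comm] at this
      refine (ih.add step).congr_left fun h => ?_
      rw [Finset.sum_insert hi, Finset.sum_insert hi]
      rw [show x + (b.repr h i • b i + ∑ j ∈ S, b.repr h j • b j)
        = x + ∑ j ∈ S, b.repr h j • b j + b.repr h i • b i by abel]
      ring
  rw [hasFDerivAt_iff_isLittleO_nhds_zero]
  refine (key Finset.univ).congr_left fun h => ?_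
  rw [b.sum_repr]
  simp [mul_comm]

/-- If all members of a class of functions are continuous and their line derivatives in the
directions of a basis belong to the class, then all members are smooth. -/
theorem contDiffOn_of_lineDeriv_closed {W ι : Type*} [NormedAddCommGroup W] [NormedSpace ℝ W]
    [FiniteDimensional ℝ W] [Fintype ι] (b : Module.Basis ι ℝ W) {U : Set W} (hU : IsOpen U)
    (S : Set (W → ℝ)) (hc : ∀ f ∈ S, ContinuousOn f U)
    (hd : ∀ f ∈ S, ∀ i, ∃ g ∈ S, ∀ x ∈ U, HasLineDerivAt ℝ f (g x) x (b i)) :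
    ∀ f ∈ S, ContDiffOn ℝ ∞ f U := by
  -- The induction treats all members at once: the Fréchet derivative of a member is a combination,
  -- with constant coefficients, of members of the class.
  have hn : ∀ n : ℕ, ∀ f ∈ S, ContDiffOn ℝ n f U := by
    intro n
    induction n with
    | zero => intro f hf; simpa using (contDiffOn_zero (𝕜 := ℝ)).2 (hc f hf)
    | succ n ih =>
      intro f hf
      choose g hgS hg using hd f hf
      have hF : ∀ x ∈ U, HasFDerivAt f
        (∑ i, g i x • (b.coord i).toContinuousLinearMap : W →L[ℝ] ℝ) x :=
        fun x hx => hasFDerivAt_of_basis_lineDeriv b (hU.mem_nhds hx) hg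
          fun i => (hc _ (hgS i)).continuousAt (hU.mem_nhds hx)
      rw [Nat.cast_add, Nat.cast_one, contDiffOn_succ_iff_hasFDerivWithinAt_of_uniqueDiffOn
        hU.uniqueDiffOn]
      refine ⟨by simp, fun x => (∑ i, g i x • (b.coord i).toContinuousLinearMap : W →L[ℝ] ℝ), ?_,
        fun x hx => (hF x hx).hasFDerivWithinAt⟩
      exact ContDiffOn.sum fun i _ => (ih _ (hgS i)).smul contDiffOn_const
  intro f hf
  exact contDiffOn_infty.2 fun n => hn n f hf

variable {E : Type*} [NormedAddCommGroup E] [NormedSpace ℝ E] [FiniteDimensional ℝ E]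

instance finiteDimensional_continuousMultilinearMap (j : ℕ) :
    FiniteDimensional ℝ (E [×j]→L[ℝ] ℝ) :=
  FiniteDimensional.of_injective
    (ContinuousMultilinearMap.toMultilinearMapLinear :
      (E [×j]→L[ℝ] ℝ) →ₗ[ℝ] MultilinearMap ℝ (fun _ : Fin j => E) ℝ)
    ContinuousMultilinearMap.toMultilinearMap_injective

/-- Taylor's estimate for the derivatives of a function whose `p`-jet at `y` vanishes. -/
theorem exists_bound_iteratedFDeriv_of_flat {h : E → ℝ} (hh : ContDiff ℝ ∞ h) {p : ℕ} {y : E}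
    (h0 : ∀ j ≤ p, iteratedFDeriv ℝ j h y = 0) (R : ℝ) (j : ℕ) (hj : j ≤ p) :
    ∃ C, 0 ≤ C ∧ ∀ z ∈ Metric.closedBall y R,
      ‖iteratedFDeriv ℝ (p - j) h z‖ ≤ C * ‖z - y‖ ^ (j + 1) := by
  have hdiff : ∀ m, Differentiable ℝ (iteratedFDeriv ℝ m h) := fun m =>
    hh.differentiable_iteratedFDeriv (by exact_mod_cast ENat.natCast_lt_top m)
  -- The derivative of order `m` vanishes at `y`, so the mean value inequality on the ball of radius
  -- `‖z - y‖` gains one power of `‖z - y‖`. Starting from a bounded derivative of order `p + 1`,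
  -- this descends to every order.
  have step : ∀ m ≤ p, ∀ n : ℕ, ∀ C, (∀ z ∈ Metric.closedBall y R,
      ‖iteratedFDeriv ℝ (m + 1) h z‖ ≤ C * ‖z - y‖ ^ n) → 0 ≤ C →
      ∀ z ∈ Metric.closedBall y R, ‖iteratedFDeriv ℝ m h z‖ ≤ C * ‖z - y‖ ^ (n + 1) := by
    intro m hm n C hC hC0 z hz
    have hsub : Metric.closedBall y ‖z - y‖ ⊆ Metric.closedBall y R :=
      Metric.closedBall_subset_closedBall (mem_closedBall_iff_norm.1 hz)
    have := (convex_closedBall y ‖z - y‖).norm_image_sub_le_of_norm_fderiv_le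
      (f := iteratedFDeriv ℝ m h) (C := C * ‖z - y‖ ^ n) (𝕜 := ℝ) (x := y) (y := z)
      (fun w _ => hdiff m w) (fun w hw => by
        rw [norm_fderiv_iteratedFDeriv]
        refine (hC w (hsub hw)).trans ?_
        have := mem_closedBall_iff_norm.1 hw
        gcongr) (Metric.mem_closedBall_self (norm_nonneg _)) (by simp [dist_eq_norm])
    rw [h0 m hm, sub_zero] at this
    calc _ ≤ _ := this
      _ = _ := by ring
  induction j with
  | zero =>
    obtain ⟨C, hC⟩ := (isCompact_closedBall y R).exists_bound_of_continuousOn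
      (hh.continuous_iteratedFDeriv (m := p + 1) (by exact_mod_cast le_top)).continuousOn
    refine ⟨max C 0, le_max_right _ _, ?_⟩
    exact step p le_rfl 0 _ (fun z hz => by simpa using Or.inl (hC z hz)) (le_max_right _ _)
  | succ j ih =>
    obtain ⟨C, hC0, hC⟩ := ih (by omega)
    refine ⟨C, hC0, ?_⟩
    refine step (p - (j + 1)) (by omega) (j + 1) C (fun z hz => ?_) hC0
    rw [show p - (j + 1) + 1 = p - j by omega]
    exact hC z hz

/-- A function whose `p`-jet at `y` vanishes becomes arbitrarily small in `C^p` after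
multiplication by a suitable cutoff function. -/
theorem exists_cutoff_of_flat {h : E → ℝ} (hh : ContDiff ℝ ∞ h) {p : ℕ} {y : E}
    (h0 : ∀ j ≤ p, iteratedFDeriv ℝ j h y = 0) {δ : ℝ} (hδ : 0 < δ) {ε : ℝ} (hε : 0 < ε) :
    ∃ ρ : E → ℝ, ContDiff ℝ ∞ ρ ∧ tsupport ρ ⊆ Metric.closedBall y δ ∧ (∀ᶠ z in 𝓝 y, ρ z = 1) ∧
      ∀ j ≤ p, ∀ z, ‖iteratedFDeriv ℝ j (fun z => ρ z * h z) z‖ ≤ ε := by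
  let β : ContDiffBump (0 : E) := ⟨1, 2, one_pos, one_lt_two⟩
  have hβ : ContDiff ℝ ∞ (β : E → ℝ) := β.contDiff
  have hM : ∀ i : ℕ, ∃ M, ∀ z, ‖iteratedFDeriv ℝ i (β : E → ℝ) z‖ ≤ M := fun i =>
    (hβ.continuous_iteratedFDeriv (m := i) (by exact_mod_cast le_top)).bounded_above_of_compact_support
      (β.hasCompactSupport.iteratedFDeriv i)
  choose M hM using hM
  choose! C hC0 hC using exists_bound_iteratedFDeriv_of_flat hh h0 2
  -- `C (p - (j - i))` is the Taylor constant for the derivative of order `j - i`; the powers of `2`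
  -- arise because the cutoff lives on a ball of radius `2 * r`.
  set A : ℝ := ∑ j ∈ Finset.range (p + 1), ∑ i ∈ Finset.range (j + 1),
    (j.choose i : ℝ) * |M i| * (C (p - (j - i)) * 2 ^ (p - (j - i) + 1)) with hA
  have hApos : ∀ j ≤ p, ∑ i ∈ Finset.range (j + 1),
    (j.choose i : ℝ) * |M i| * (C (p - (j - i)) * 2 ^ (p - (j - i) + 1)) ≤ A := by
    intro j hj
    rw [hA]
    refine Finset.single_le_sum (f := fun j => ∑ i ∈ Finset.range (j + 1),
      (j.choose i : ℝ) * |M i| * (C (p - (j - i)) * 2 ^ (p - (j - i) + 1))) (fun j' _ => ?_)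
      (Finset.mem_range.2 (by omega))
    refine Finset.sum_nonneg fun i _ => ?_
    have := hC0 (p - (j' - i)) (by omega)
    positivity
  have hA0 : 0 ≤ A := by
    refine le_trans (Finset.sum_nonneg fun i _ => ?_) (hApos 0 (by omega))
    have := hC0 (p - (0 - i)) (by omega)
    positivity
  -- `r ≤ 1` keeps the support inside the ball of radius `2` where the Taylor bounds hold and lets
  -- higher powers of `r` be dropped.
  obtain ⟨r, hr0, hr1, hrδ, hrε⟩ : ∃ r : ℝ, 0 < r ∧ r ≤ 1 ∧ 2 * r ≤ δ ∧ A * r ≤ ε := by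
    refine ⟨min 1 (min (δ / 2) (ε / (A + 1))), by positivity, min_le_left _ _, ?_, ?_⟩
    · have : min 1 (min (δ / 2) (ε / (A + 1))) ≤ δ / 2 :=
        (min_le_right _ _).trans (min_le_left _ _)
      linarith
    · have : min 1 (min (δ / 2) (ε / (A + 1))) ≤ ε / (A + 1) :=
        (min_le_right _ _).trans (min_le_right _ _)
      calc A * min 1 (min (δ / 2) (ε / (A + 1))) ≤ (A + 1) * (ε / (A + 1)) := by
            gcongr
            linarith
        _ = ε := by field_simp
  set ρ : E → ℝ := fun z => β (r⁻¹ • (z - y)) with hρ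
  have hρs : ContDiff ℝ ∞ ρ := hβ.comp ((contDiff_id.sub contDiff_const).const_smul _)
  have hsupp : ∀ z, z ∉ Metric.closedBall y (2 * r) → ρ z = 0 := by
    intro z hz
    refine β.zero_of_le_dist ?_
    rw [dist_zero_right, norm_smul, norm_inv, Real.norm_of_nonneg hr0.le]
    rw [mem_closedBall_iff_norm, not_le] at hz
    change 2 ≤ _
    rw [inv_mul_eq_div, le_div_iff₀ hr0]
    exact hz.le
  have hts : tsupport ρ ⊆ Metric.closedBall y (2 * r) :=
    closure_minimal (fun z hz => by_contra fun hz' => hz (hsupp z hz')) Metric.isClosed_closedBall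
  have hρi : ∀ i z, ‖iteratedFDeriv ℝ i ρ z‖ ≤ |M i| * (r⁻¹) ^ i := by
    intro i z
    have h1 : iteratedFDeriv ℝ i ρ z = (r⁻¹) ^ i • iteratedFDeriv ℝ i β (r⁻¹ • (z - y)) := by
      have h2 := iteratedFDeriv_comp_const_smul (f := (β : E → ℝ)) (i := i) r⁻¹
        (hβ.of_le (by exact_mod_cast le_top))
      have h3 := iteratedFDeriv_comp_add_right (𝕜 := ℝ) (f := fun z : E => β (r⁻¹ • z)) i (-y) z
      rw [h2] at h3
      simpa only [← sub_eq_add_neg] using h3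
    rw [h1, norm_smul, norm_pow, norm_inv, Real.norm_of_nonneg hr0.le, mul_comm]
    gcongr
    exact (hM i _).trans (le_abs_self _)
  refine ⟨ρ, hρs, hts.trans (Metric.closedBall_subset_closedBall hrδ), ?_, ?_⟩
  · have : Metric.ball y r ∈ 𝓝 y := Metric.ball_mem_nhds _ hr0
    filter_upwards [this] with z hz
    refine β.one_of_mem_closedBall ?_
    rw [mem_closedBall_zero_iff, norm_smul, norm_inv, Real.norm_of_nonneg hr0.le]
    change _ ≤ (1 : ℝ)
    rw [inv_mul_eq_div, div_le_one hr0]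
    exact (mem_ball_iff_norm.1 hz).le
  · intro j hj z
    by_cases hz : z ∈ Metric.closedBall y (2 * r)
    · refine (norm_iteratedFDeriv_mul_le hρs hh z (n := j) (by exact_mod_cast le_top)).trans ?_
      have hz2 : z ∈ Metric.closedBall y 2 :=
        Metric.closedBall_subset_closedBall (by linarith) hz
      have hzn : ‖z - y‖ ≤ 2 * r := mem_closedBall_iff_norm.1 hz
      calc _ ≤ ∑ i ∈ Finset.range (j + 1),
          ((j.choose i : ℝ) * |M i| * (C (p - (j - i)) * 2 ^ (p - (j - i) + 1))) * r := by
            refine Finset.sum_le_sum fun i hi => ?_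
            have hij : i ≤ j := by simpa [Nat.lt_succ_iff] using hi
            have h1 := hC (p - (j - i)) (by omega) z hz2
            rw [show p - (p - (j - i)) = j - i by omega] at h1
            have h2 : C (p - (j - i)) * ‖z - y‖ ^ (p - (j - i) + 1) ≤
                C (p - (j - i)) * (2 * r) ^ (p - (j - i) + 1) := by
              have := hC0 (p - (j - i)) (by omega)
              gcongr
            have hC' := hC0 (p - (j - i)) (by omega)
            calc _ ≤ (j.choose i : ℝ) * (|M i| * r⁻¹ ^ i) *
                  (C (p - (j - i)) * (2 * r) ^ (p - (j - i) + 1)) := by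
                  gcongr
                  · exact hρi i z
                  · exact h1.trans h2
              _ = ((j.choose i : ℝ) * |M i| * (C (p - (j - i)) * 2 ^ (p - (j - i) + 1))) *
                  (r⁻¹ ^ i * r ^ (p - (j - i) + 1)) := by rw [mul_pow]; ring
              _ ≤ _ := by
                  gcongr
                  -- Power count: `i` derivatives on the cutoff cost `r⁻ⁱ`, the flat factor gives
                  -- `r^(p - j + i + 1)`, and at least one power of `r` is left.
                  rw [show p - (j - i) + 1 = i + ((p - j) + 1) by omega, pow_add, ← mul_assoc,
                    ← mul_pow, inv_mul_cancel₀ hr0.ne', one_pow, one_mul, pow_succ]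
                  exact mul_le_of_le_one_left hr0.le (pow_le_one₀ hr0.le hr1)
        _ ≤ A * r := by
            rw [← Finset.sum_mul]
            gcongr
            exact hApos j hj
        _ ≤ ε := hrε
    · have : (fun z => ρ z * h z) =ᶠ[𝓝 z] fun _ => 0 := by
        filter_upwards [Metric.isClosed_closedBall.isOpen_compl.mem_nhds hz] with w hw
        rw [hsupp w hw, zero_mul]
      rw [(this.iteratedFDeriv ℝ j).eq_of_nhds]
      have h00 : iteratedFDeriv ℝ j (fun _ : E => (0 : ℝ)) z = 0 := by
        simp
      rw [h00, norm_zero]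
      exact hε.le

end Analysis

/-! ### Jets in a vector space: realization by functions, change of coordinates, convex gluing. -/

section Jets

variable {E : Type*} [NormedAddCommGroup E] [NormedSpace ℝ E]

/-- The derivatives of orders `0, …, p` of `f` at `y`. -/
def taylorJet (p : ℕ) (f : E → ℝ) (y : E) : JetCoeff E p :=
  fun j => iteratedFDeriv ℝ j f y

theorem taylorJet_congr {p : ℕ} {f g : E → ℝ} {y : E} (h : f =ᶠ[𝓝 y] g) :
    taylorJet p f y = taylorJet p g y :=
  funext fun j => (h.iteratedFDeriv ℝ j).eq_of_nhds

theorem taylorJet_comp_sub (p : ℕ) (f : E → ℝ) (a y : E) :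
    taylorJet p (fun z => f (z - a)) y = taylorJet p f (y - a) := by
  funext j
  simpa only [← sub_eq_add_neg, taylorJet] using
    iteratedFDeriv_comp_add_right (𝕜 := ℝ) (f := f) j (-a) y

theorem taylorJet_add {p : ℕ} {f g : E → ℝ} {y : E} (hf : ContDiffAt ℝ ∞ f y)
    (hg : ContDiffAt ℝ ∞ g y) :
    taylorJet p (fun z => f z + g z) y = taylorJet p f y + taylorJet p g y := by
  funext j
  exact fun_iteratedFDeriv_add_apply (hf.of_le (by exact_mod_cast le_top))
    (hg.of_le (by exact_mod_cast le_top))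

theorem taylorJet_const_smul {p : ℕ} {f : E → ℝ} {y : E} (c : ℝ) (hf : ContDiffAt ℝ ∞ f y) :
    taylorJet p (fun z => c • f z) y = c • taylorJet p f y := by
  funext j
  exact iteratedFDeriv_const_smul_apply' (hf.of_le (by exact_mod_cast le_top))

theorem contDiffOn_iteratedFDeriv {f : E → ℝ} {U : Set E} (hU : IsOpen U)
    (hf : ContDiffOn ℝ ∞ f U) (m : ℕ) : ContDiffOn ℝ ∞ (iteratedFDeriv ℝ m f) U := by
  refine ContDiffOn.congr (f := iteratedFDerivWithin ℝ m f U) ?_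
    fun y hy => (iteratedFDerivWithin_of_isOpen m hU hy).symm
  exact fun y hy => (hf y hy).iteratedFDerivWithin_right hU.uniqueDiffOn (le_of_eq rfl) hy

theorem contDiffOn_taylorJet {f : E → ℝ} {U : Set E} (hU : IsOpen U)
    (hf : ContDiffOn ℝ ∞ f U) (p : ℕ) : ContDiffOn ℝ ∞ (taylorJet p f) U :=
  contDiffOn_pi.2 fun j => contDiffOn_iteratedFDeriv hU hf j

variable [FiniteDimensional ℝ E]

variable (E) in
/-- The space of smooth functions on a vector space, as a submodule. -/
def smoothSubmodule : Submodule ℝ (E → ℝ) where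
  carrier := {f | ContDiff ℝ ∞ f}
  add_mem' hf hg := ContDiff.add (mem_ofPred.1 hf) (mem_ofPred.1 hg)
  zero_mem' := (contDiff_const : ContDiff ℝ ∞ fun _ : E => (0 : ℝ))
  smul_mem' c _ hf := ContDiff.const_smul c (mem_ofPred.1 hf)

variable (E) in
/-- The `p`-jet at `0` of the smooth functions on a vector space, as a linear map. -/
def taylorJetZero (p : ℕ) : smoothSubmodule E →ₗ[ℝ] JetCoeff E p where
  toFun f := taylorJet p f.1 0
  map_add' f g := taylorJet_add (ContDiff.contDiffAt f.2) (ContDiff.contDiffAt g.2)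
  map_smul' c f := taylorJet_const_smul c (ContDiff.contDiffAt f.2)

/-- `JetCoeff` also contains non-symmetric forms, which are not jets. The genuine jets form one
subspace, independent of the base point, because a function can be cut off and translated to `0`. -/
theorem taylorJet_mem_range {p : ℕ} {f : E → ℝ} {U : Set E} {y : E} (hU : U ∈ 𝓝 y)
    (hf : ContDiffOn ℝ ∞ f U) :
    taylorJet p f y ∈ LinearMap.range (taylorJetZero E p) := by
  obtain ⟨δ, hδ, hball⟩ := Metric.mem_nhds_iff.1 hU
  let β : ContDiffBump (y : E) := ⟨δ / 3, δ / 2, by positivity, by linarith⟩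
  have hsupp : tsupport β ⊆ Metric.ball y δ := by
    rw [β.tsupport_eq]
    exact Metric.closedBall_subset_ball (by change δ / 2 < δ; linarith)
  have hs : ContDiff ℝ ∞ (fun z => β z * f z) := by
    refine contDiff_iff_contDiffAt.2 fun z => ?_
    by_cases hz : z ∈ tsupport β
    · exact β.contDiff.contDiffAt.mul
        (hf.contDiffAt (Filter.mem_of_superset (Metric.isOpen_ball.mem_nhds (hsupp hz)) hball))
    · have : (fun z => β z * f z) =ᶠ[𝓝 z] fun _ => 0 := by
        filter_upwards [(isClosed_tsupport _).isOpen_compl.mem_nhds hz] with w hw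
        rw [image_eq_zero_of_notMem_tsupport hw, zero_mul]
      exact contDiffAt_const.congr_of_eventuallyEq this
  refine ⟨⟨fun z => β (z + y) * f (z + y), hs.comp (contDiff_id.add contDiff_const)⟩, ?_⟩
  change taylorJet p (fun z => β (z + y) * f (z + y)) 0 = _
  have h1 := taylorJet_comp_sub p (fun z => β z * f z) (-y) 0
  simp only [sub_neg_eq_add, zero_add] at h1
  rw [h1]
  refine taylorJet_congr ?_
  filter_upwards [β.eventuallyEq_one] with z hz
  rw [hz]
  simp

omit [NormedAddCommGroup E] [NormedSpace ℝ E] [FiniteDimensional ℝ E] in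
theorem exists_linearMap_inverse_on_range {V W : Type*} [AddCommGroup V] [Module ℝ V]
    [AddCommGroup W] [Module ℝ W] (f : V →ₗ[ℝ] W) :
    ∃ g : W →ₗ[ℝ] V, ∀ w ∈ LinearMap.range f, f (g w) = w := by
  obtain ⟨S, hS⟩ := f.rangeRestrict.exists_rightInverse_of_surjective
    (LinearMap.range_eq_top.2 f.surjective_rangeRestrict)
  obtain ⟨g, hg⟩ := S.exists_extend
  refine ⟨g, fun w hw => ?_⟩
  have h1 : g w = S ⟨w, hw⟩ := LinearMap.congr_fun hg ⟨w, hw⟩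
  rw [h1]
  exact congrArg Subtype.val (LinearMap.congr_fun hS ⟨w, hw⟩)

theorem contDiffAt_ringInverse_of_isUnit {V : Type*} [NormedAddCommGroup V] [NormedSpace ℝ V]
    [FiniteDimensional ℝ V] {A : V →L[ℝ] V} (hA : IsUnit A) : ContDiffAt ℝ ∞ Ring.inverse A := by
  have := FiniteDimensional.complete ℝ V
  obtain ⟨u, rfl⟩ := hA
  exact contDiffAt_ringInverse ℝ u

theorem eventually_isUnit_nhds_one (V : Type*) [NormedAddCommGroup V] [NormedSpace ℝ V]
    [FiniteDimensional ℝ V] : ∀ᶠ A in 𝓝 (1 : V →L[ℝ] V), IsUnit A := by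
  have := FiniteDimensional.complete ℝ V
  exact Units.nhds (1 : (V →L[ℝ] V)ˣ)

variable (E) in
/-- A finite-dimensional family of smooth functions realizing all `p`-jets near `0`, with
coefficients depending smoothly on the base point. -/
theorem exists_jet_family (p : ℕ) :
    ∃ (Q : JetCoeff E p →ₗ[ℝ] (E → ℝ)) (T : E → JetCoeff E p →L[ℝ] JetCoeff E p),
      (∀ s, ContDiff ℝ ∞ (Q s)) ∧
      ∀ᶠ z in 𝓝 (0 : E), ContDiffAt ℝ ∞ T z ∧ ∀ (f : E → ℝ) (U : Set E) (y : E), U ∈ 𝓝 y → ContDiffOn ℝ ∞ f U →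
        taylorJet p (Q (T z (taylorJet p f y))) z = taylorJet p f y := by
  set R := LinearMap.range (taylorJetZero E p) with hR
  obtain ⟨S, hS⟩ := exists_linearMap_inverse_on_range (taylorJetZero E p)
  let π : JetCoeff E p →ₗ[ℝ] JetCoeff E p := taylorJetZero E p ∘ₗ S
  have hπ : ∀ a, π a ∈ R := fun a => ⟨S a, rfl⟩
  have hπR : ∀ a ∈ R, π a = a := hS
  let Q : JetCoeff E p →ₗ[ℝ] (E → ℝ) := (smoothSubmodule E).subtype ∘ₗ S
  have hQ : ∀ s, ContDiff ℝ ∞ (Q s) := fun s => (S s).2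
  -- The term `s - π s` is the identity on a complement of the genuine jets. It makes `J 0` the
  -- identity of the whole coefficient space, so that `J z` is invertible for `z` near `0`.
  let J : E → JetCoeff E p →ₗ[ℝ] JetCoeff E p := fun z =>
    { toFun := fun s => taylorJet p (Q s) z + (s - π s)
      map_add' := fun s t => by
        rw [map_add, show Q s + Q t = fun z => Q s z + Q t z from rfl,
          taylorJet_add (hQ s).contDiffAt (hQ t).contDiffAt]
        rw [map_add]
        abel
      map_smul' := fun c s => by
        rw [map_smul, show c • Q s = fun z => c • Q s z from rfl,
          taylorJet_const_smul c (hQ s).contDiffAt]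
        simp only [map_smul, smul_add, smul_sub, RingHom.id_apply] }
  let JL : E → JetCoeff E p →L[ℝ] JetCoeff E p := fun z => (J z).toContinuousLinearMap
  have hJL : ContDiff ℝ ∞ JL := by
    refine contDiff_clm_apply_iff.2 fun s => ?_
    change ContDiff ℝ ∞ fun z => taylorJet p (Q s) z + (s - π s)
    exact (contDiffOn_univ.1 (contDiffOn_taylorJet isOpen_univ (hQ s).contDiffOn p)).add
      contDiff_const
  have hJ0 : JL 0 = 1 := by
    ext1 s
    change taylorJet p (Q s) 0 + (s - π s) = s
    have h1 : taylorJet p (Q s) 0 = π s := rfl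
    rw [h1]
    abel
  refine ⟨Q, fun z => Ring.inverse (JL z), hQ, ?_⟩
  have hunit : ∀ᶠ z in 𝓝 (0 : E), IsUnit (JL z) := by
    refine hJL.continuous.continuousAt.eventually ?_
    rw [hJ0]
    exact eventually_isUnit_nhds_one _
  filter_upwards [hunit] with z hz
  refine ⟨(contDiffAt_ringInverse_of_isUnit hz).comp z hJL.contDiffAt, fun f U y hU hf => ?_⟩
  have ha := taylorJet_mem_range (p := p) hU hf
  set a := taylorJet p f y
  set s := Ring.inverse (JL z) a with hs
  have h1 : JL z s = a := by
    have := congrArg (fun A : JetCoeff E p →L[ℝ] JetCoeff E p => A a)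
      (Ring.mul_inverse_cancel _ hz)
    simpa using this
  change taylorJet p (Q s) z + (s - π s) = a at h1
  -- Both `a` and the jet of `Q s` are genuine, hence so are `s - π s` and `s`; then `π s = s` and
  -- the auxiliary term disappears.
  have h2 : taylorJet p (Q s) z ∈ R := taylorJet_mem_range univ_mem (hQ s).contDiffOn
  have h3 : s - π s ∈ R := by
    rw [show s - π s = a - taylorJet p (Q s) z by rw [← h1]; abel]
    exact R.sub_mem ha h2
  have h4 : s ∈ R := by simpa using R.add_mem h3 (hπ s)
  rw [hπR s h4, sub_self, add_zero] at h1
  exact h1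

/-- The `p`-jet of `f ∘ σ` at `z`, expressed through the `p`-jet `a` of `f` at `σ z` by the formula
of Faà di Bruno. -/
def jetTransition (p : ℕ) (σ : E → E) (z : E) (a : JetCoeff E p) : JetCoeff E p :=
  fun j => ∑ c : OrderedFinpartition j,
    c.compAlongOrderedFinpartition (a ⟨c.length, lt_of_le_of_lt c.length_le j.2⟩)
      fun i => iteratedFDeriv ℝ (c.partSize i) σ z

omit [FiniteDimensional ℝ E] in
theorem taylorJet_comp {p : ℕ} {f : E → ℝ} {σ : E → E} {z : E} (hf : ContDiffAt ℝ ∞ f (σ z))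
    (hσ : ContDiffAt ℝ ∞ σ z) :
    taylorJet p (f ∘ σ) z = jetTransition p σ z (taylorJet p f (σ z)) := by
  funext j
  exact iteratedFDeriv_comp hf hσ (by exact_mod_cast le_top)

/-- The transition is linear in the jet, so expanding the jet in a basis separates the variables and
leaves smoothness in the base point alone. -/
theorem contDiffOn_jetTransition (p : ℕ) {σ : E → E} {U : Set E} (hU : IsOpen U)
    (hσ : ContDiffOn ℝ ∞ σ U) :
    ContDiffOn ℝ ∞ (fun q : E × JetCoeff E p => jetTransition p σ q.1 q.2) (U ×ˢ univ) := by
  have hD : ∀ m : ℕ, ContDiffOn ℝ ∞ (iteratedFDeriv ℝ m σ) U := by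
    intro m
    refine ContDiffOn.congr (f := iteratedFDerivWithin ℝ m σ U) ?_
      fun y hy => (iteratedFDerivWithin_of_isOpen m hU hy).symm
    exact fun y hy => (hσ y hy).iteratedFDerivWithin_right hU.uniqueDiffOn (le_of_eq rfl) hy
  let b := Module.finBasis ℝ (JetCoeff E p)
  have hlin : ∀ z, IsLinearMap ℝ (jetTransition p σ z) := fun z =>
    { map_add := fun a a' => by
        funext j
        simp only [jetTransition, Pi.add_apply, ← Finset.sum_add_distrib]
        rfl
      map_smul := fun c a => by
        funext j
        simp only [jetTransition, Pi.smul_apply, Finset.smul_sum]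
        rfl }
  have hexp : ∀ z a, jetTransition p σ z a = ∑ i, b.repr a i • jetTransition p σ z (b i) := by
    intro z a
    conv_lhs => rw [← b.sum_repr a]
    have := map_sum ((hlin z).mk' _) (fun i => b.repr a i • b i) Finset.univ
    simpa only [IsLinearMap.mk'_apply, (hlin z).map_smul] using this
  refine ContDiffOn.congr (f := fun q : E × JetCoeff E p =>
    ∑ i, b.repr q.2 i • jetTransition p σ q.1 (b i)) ?_ fun q _ => hexp q.1 q.2
  refine ContDiffOn.sum fun i _ => ContDiffOn.smul (𝕜 := ℝ)
    (f := fun q : E × JetCoeff E p => b.repr q.2 i)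
    (g := fun q : E × JetCoeff E p => jetTransition p σ q.1 (b i)) ?_ ?_
  · exact ((b.coord i).toContinuousLinearMap.contDiff.comp contDiff_snd).contDiffOn
  · refine ContDiffOn.comp (g := fun z => jetTransition p σ z (b i)) (t := U) ?_
      contDiff_fst.contDiffOn fun q hq => hq.1
    refine contDiffOn_pi.2 fun j => ContDiffOn.sum fun c _ => ?_
    exact ((c.compAlongOrderedFinpartitionL ℝ E E ℝ _).contDiff).comp_contDiffOn
      (contDiffOn_pi.2 fun i => hD _)

/-- Smooth functions on an open subset of a vector space that are prescribed locally up to convex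
constraints exist globally. -/
theorem exists_contDiffOn_forall_mem_convex {W : Type*} [NormedAddCommGroup W] [NormedSpace ℝ W]
    [FiniteDimensional ℝ W] {O : Set W} (hO : IsOpen O) (t : W → Set ℝ)
    (ht : ∀ w ∈ O, Convex ℝ (t w))
    (hloc : ∀ w ∈ O, ∃ U ∈ 𝓝 w, ∃ g : W → ℝ, ContDiffOn ℝ ∞ g U ∧ ∀ v ∈ U ∩ O, g v ∈ t v) :
    ∃ g : W → ℝ, ContDiffOn ℝ ∞ g O ∧ ∀ w ∈ O, g w ∈ t w := by
  let O' : TopologicalSpace.Opens W := ⟨O, hO⟩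
  have : LocallyCompactSpace O' := hO.locallyCompactSpace
  obtain ⟨g, hg⟩ := exists_contMDiffMap_forall_mem_convex_of_local 𝓘(ℝ, W) (M := O')
    (t := fun w => t w.1) (n := ⊤) (fun w => ht w.1 w.2) fun w => by
      obtain ⟨U, hU, g, hg, hgt⟩ := hloc w.1 w.2
      refine ⟨Subtype.val ⁻¹' U, continuous_subtype_val.continuousAt.preimage_mem_nhds hU,
        g ∘ Subtype.val, ?_, fun v hv => hgt v.1 ⟨hv, v.2⟩⟩
      exact hg.contMDiffOn.comp (contMDiff_subtype_val.contMDiffOn) fun v hv => hv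
  classical
  refine ⟨fun w => if h : w ∈ O then g ⟨w, h⟩ else 0, fun w hw => ?_, fun w hw => ?_⟩
  · refine ContDiffAt.contDiffWithinAt (contMDiffAt_iff_contDiffAt.1 ?_)
    refine (contMDiffAt_subtype_iff (U := O') (x := ⟨w, hw⟩)).1 ?_
    refine (g.contMDiff ⟨w, hw⟩).congr_of_eventuallyEq (Eventually.of_forall fun v => ?_)
    exact dif_pos v.2
  · simp only [hw, dif_pos]
    exact hg ⟨w, hw⟩

end Jets

/-! ### The manifold structure of `Nᵏ`. -/

section PiManifold

variable {E : Type*} [NormedAddCommGroup E] [NormedSpace ℝ E] {H : Type*} [TopologicalSpace H]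
  {I : ModelWithCorners ℝ E H} {N : Type*} [TopologicalSpace N] [ChartedSpace H N]

instance boundaryless_pi [I.Boundaryless] (k : ℕ) :
    (ModelWithCorners.pi fun _ : Fin k => I).Boundaryless where
  range_eq_univ := by
    refine eq_univ_of_forall fun y => ⟨fun i => I.symm (y i), ?_⟩
    funext i
    exact I.right_inv (by rw [I.range_eq_univ]; trivial)

omit [ChartedSpace H N] in
theorem mem_extend_pi_target [I.Boundaryless] {k : ℕ} (e : Fin k → OpenPartialHomeomorph N H)
    (y : Fin k → E) :
    y ∈ ((OpenPartialHomeomorph.pi e).extend (ModelWithCorners.pi fun _ : Fin k => I)).target ↔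
      ∀ i, y i ∈ ((e i).extend I).target := by
  have h : range (ModelWithCorners.pi fun _ : Fin k => I) = univ :=
    (boundaryless_pi k).range_eq_univ
  rw [OpenPartialHomeomorph.extend_target, h, inter_univ]
  simp only [OpenPartialHomeomorph.extend_target, ModelWithCorners.range_eq_univ, inter_univ]
  change _ ∈ univ.pi _ ↔ _
  simp only [Set.mem_pi, mem_univ, true_imp_iff]
  rfl

theorem contDiffOn_chart_transition [IsManifold I ∞ N] [I.Boundaryless]
    {e e' : OpenPartialHomeomorph N H} (he : e ∈ atlas H N) (he' : e' ∈ atlas H N) :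
    ContDiffOn ℝ ∞ (e'.extend I ∘ (e.extend I).symm)
      ((e.extend I).target ∩ (e.extend I).symm ⁻¹' e'.source) := by
  have := ModelWithCorners.contDiffOn_extendCoordChange (I := I) (n := ∞)
    (IsManifold.subset_maximalAtlas he) (IsManifold.subset_maximalAtlas he')
  refine this.mono ?_
  intro y hy
  simp only [ModelWithCorners.extendCoordChange, PartialEquiv.trans_source,
    PartialEquiv.symm_source, OpenPartialHomeomorph.extend_source]
  exact hy

omit [ChartedSpace H N] in
theorem isOpen_chart_overlap [I.Boundaryless] (e e' : OpenPartialHomeomorph N H) :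
    IsOpen ((e.extend I).target ∩ (e.extend I).symm ⁻¹' e'.source) :=
  (e.continuousOn_extend_symm).isOpen_inter_preimage e.isOpen_extend_target e'.open_source

instance isManifold_pi [IsManifold I ∞ N] [I.Boundaryless] (k : ℕ) :
    IsManifold (ModelWithCorners.pi fun _ : Fin k => I) ∞ (Fin k → N) := by
  refine isManifold_of_contDiffOn _ _ _ ?_
  rintro _ _ ⟨e, he, rfl⟩ ⟨e', he', rfl⟩
  refine contDiffOn_pi.2 fun i => ?_
  have h := contDiffOn_chart_transition (I := I) (he i (mem_univ i)) (he' i (mem_univ i))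
  refine h.comp (g := ((e' i).extend I ∘ ((e i).extend I).symm))
    (f := fun y : Fin k → E => y i) (contDiff_apply ℝ E i).contDiffOn ?_
  intro y hy
  have h1 := hy.1
  rw [mem_preimage, OpenPartialHomeomorph.trans_source] at h1
  refine ⟨?_, ?_⟩
  · simp only [OpenPartialHomeomorph.extend_target, ModelWithCorners.range_eq_univ, inter_univ]
    exact h1.1 i (mem_univ i)
  · exact h1.2 i (mem_univ i)

end PiManifold

/-! ### Derivatives in charts and the topology of `C^∞(N)`. -/

section Manifold

variable {E : Type*} [NormedAddCommGroup E] [NormedSpace ℝ E] {H : Type*} [TopologicalSpace H]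
  {I : ModelWithCorners ℝ E H} {N : Type*} [TopologicalSpace N] [ChartedSpace H N]

theorem contDiffOn_chart [IsManifold I ∞ N] [I.Boundaryless] {e : OpenPartialHomeomorph N H}
    (he : e ∈ atlas H N) (f : SmoothFun I N) :
    ContDiffOn ℝ ∞ (f ∘ (e.extend I).symm) (e.extend I).target := by
  rw [← contMDiffOn_iff_contDiffOn]
  have h := contMDiffOn_extend_symm (I := I) (n := ∞) (IsManifold.subset_maximalAtlas he)
  rw [← OpenPartialHomeomorph.extend_target'] at h
  exact f.contMDiff.comp_contMDiffOn h

section Linear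

variable [IsManifold I ∞ N] [I.Boundaryless] {e : OpenPartialHomeomorph N H}
  (he : e ∈ atlas H N)
include he

theorem contDiffAt_chart (f : SmoothFun I N) {y : E} (hy : y ∈ (e.extend I).target) :
    ContDiffAt ℝ ∞ (f ∘ (e.extend I).symm) y :=
  (contDiffOn_chart he f).contDiffAt (e.isOpen_extend_target.mem_nhds hy)

theorem chartDeriv_add (m : ℕ) (f g : SmoothFun I N) {y : E} (hy : y ∈ (e.extend I).target) :
    chartDeriv e m (f + g) y = chartDeriv e m f y + chartDeriv e m g y :=
  fun_iteratedFDeriv_add_apply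
    ((contDiffAt_chart he f hy).of_le (by exact_mod_cast le_top))
    ((contDiffAt_chart he g hy).of_le (by exact_mod_cast le_top))

theorem chartDeriv_smul (m : ℕ) (c : ℝ) (f : SmoothFun I N) {y : E}
    (hy : y ∈ (e.extend I).target) :
    chartDeriv e m (c • f) y = c • chartDeriv e m f y :=
  iteratedFDeriv_const_smul_apply' (a := c)
    ((contDiffAt_chart he f hy).of_le (by exact_mod_cast le_top))

theorem chartDeriv_sub (m : ℕ) (f g : SmoothFun I N) {y : E} (hy : y ∈ (e.extend I).target) :
    chartDeriv e m (f - g) y = chartDeriv e m f y - chartDeriv e m g y := by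
  rw [eq_sub_iff_add_eq, ← chartDeriv_add he m _ _ hy, sub_add_cancel]

theorem contDiffOn_chartDeriv (m : ℕ) (f : SmoothFun I N) :
    ContDiffOn ℝ ∞ (chartDeriv e m f) (e.extend I).target :=
  contDiffOn_iteratedFDeriv e.isOpen_extend_target (contDiffOn_chart he f) m

theorem chartDeriv_sum {ι : Type*} (m : ℕ) (s : Finset ι) (f : ι → SmoothFun I N) {y : E}
    (hy : y ∈ (e.extend I).target) :
    chartDeriv e m (∑ i ∈ s, f i) y = ∑ i ∈ s, chartDeriv e m (f i) y := by
  classical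
  induction s using Finset.induction_on with
  | empty =>
    rw [Finset.sum_empty, Finset.sum_empty]
    have := chartDeriv_sub he m 0 0 hy
    rwa [sub_self, sub_self] at this
  | insert i s hi ih => rw [Finset.sum_insert hi, Finset.sum_insert hi, chartDeriv_add he m _ _ hy, ih]

end Linear

theorem chartDeriv_congr (e : OpenPartialHomeomorph N H) (m : ℕ) {f g : SmoothFun I N} {y : E}
    (hy : y ∈ (e.extend I).target) (h : f =ᶠ[𝓝 ((e.extend I).symm y)] g) :
    chartDeriv e m f y = chartDeriv e m g y := by
  have h1 : f ∘ (e.extend I).symm =ᶠ[𝓝 y] g ∘ (e.extend I).symm :=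
    (e.continuousAt_extend_symm' hy).eventually h
  exact (h1.iteratedFDeriv ℝ m).eq_of_nhds

/-- The working form of the topology: an infimum of induced topologies is tested on each chart,
order and compact set separately. -/
theorem tendsto_smoothFun_iff {X : Type*} {l : Filter X} {g : X → SmoothFun I N}
    {φ : SmoothFun I N} :
    Tendsto g l (𝓝 φ) ↔ ∀ e ∈ atlas H N, ∀ (m : ℕ) (K : Set E), IsCompact K →
      K ⊆ (e.extend I).target → ∀ ε > 0, ∀ᶠ x in l, ∀ y ∈ K,
        ‖chartDeriv e m (g x) y - chartDeriv e m φ y‖ < ε := by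
  simp only [nhds_iInf, tendsto_iInf, nhds_induced, tendsto_comap_iff]
  refine forall_congr' fun e => forall_congr' fun he => forall_congr' fun m => ?_
  rw [UniformOnFun.tendsto_iff_tendstoUniformlyOn]
  simp only [mem_ofPred_eq, and_imp]
  refine forall_congr' fun K => forall_congr' fun hK => forall_congr' fun hKe => ?_
  rw [Metric.tendstoUniformlyOn_iff]
  refine forall_congr' fun ε => forall_congr' fun hε => ?_
  refine eventually_congr (Eventually.of_forall fun x => ?_)
  refine forall_congr' fun y => forall_congr' fun hy => ?_
  rw [dist_comm, dist_eq_norm]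
  rfl

variable (I) in
/-- A finite family of compact sets in chart domains. -/
def IsCompactFamily (T : Set (OpenPartialHomeomorph N H × Set E)) : Prop :=
  T.Finite ∧ ∀ q ∈ T, q.1 ∈ atlas H N ∧ IsCompact q.2 ∧ q.2 ⊆ (q.1.extend I).target

/-- The functions whose derivatives of order at most `p` are `ε`-close to those of `φ` on the
compact sets of a family. -/
def jetBall (T : Set (OpenPartialHomeomorph N H × Set E)) (p : ℕ) (ε : ℝ) (φ : SmoothFun I N) :
    Set (SmoothFun I N) :=
  {f | ∀ q ∈ T, ∀ m ≤ p, ∀ y ∈ q.2, ‖chartDeriv q.1 m f y - chartDeriv q.1 m φ y‖ < ε}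

theorem jetBall_mem_nhds {T : Set (OpenPartialHomeomorph N H × Set E)} (hT : IsCompactFamily I T)
    (p : ℕ) {ε : ℝ} (hε : 0 < ε) (φ : SmoothFun I N) : jetBall T p ε φ ∈ 𝓝 φ := by
  have h := tendsto_smoothFun_iff.1 (tendsto_id (x := 𝓝 φ))
  have h1 : ∀ᶠ f in 𝓝 φ, ∀ q ∈ T, ∀ m ∈ Iic p, ∀ y ∈ q.2,
      ‖chartDeriv q.1 m f y - chartDeriv q.1 m φ y‖ < ε := by
    refine (eventually_all_finite hT.1).2 fun q hq => ?_
    refine (eventually_all_finite (finite_Iic p)).2 fun m _ => ?_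
    exact h q.1 (hT.2 q hq).1 m q.2 (hT.2 q hq).2.1 (hT.2 q hq).2.2 ε hε
  exact h1

/-- The sets containing some `jetBall` form a filter, since two balls are refined by joining the
families, raising the order and shrinking the radius. The identity tends from this filter to `φ`, so
it is finer than `𝓝 φ`. -/
theorem exists_jetBall_subset {φ : SmoothFun I N} {V : Set (SmoothFun I N)} (hV : V ∈ 𝓝 φ) :
    ∃ (T : Set (OpenPartialHomeomorph N H × Set E)) (p : ℕ) (ε : ℝ), IsCompactFamily I T ∧
      0 < ε ∧ jetBall T p ε φ ⊆ V := by
  let F : Filter (SmoothFun I N) :=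
    { sets := {V | ∃ (T : Set (OpenPartialHomeomorph N H × Set E)) (p : ℕ) (ε : ℝ),
        IsCompactFamily I T ∧ 0 < ε ∧ jetBall T p ε φ ⊆ V}
      univ_sets := ⟨∅, 0, 1, ⟨finite_empty, by simp⟩, one_pos, subset_univ _⟩
      sets_of_superset := by
        rintro V W ⟨T, p, ε, hT, hε, h⟩ hVW
        exact ⟨T, p, ε, hT, hε, h.trans hVW⟩
      inter_sets := by
        rintro V W ⟨T, p, ε, hT, hε, h⟩ ⟨T', p', ε', hT', hε', h'⟩
        refine ⟨T ∪ T', max p p', min ε ε', ⟨hT.1.union hT'.1, ?_⟩, lt_min hε hε', ?_⟩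
        · rintro q (hq | hq)
          exacts [hT.2 q hq, hT'.2 q hq]
        · intro f hf
          refine ⟨h fun q hq m hm y hy => ?_, h' fun q hq m hm y hy => ?_⟩
          · exact (hf q (Or.inl hq) m (hm.trans (le_max_left _ _)) y hy).trans_le (min_le_left _ _)
          · exact (hf q (Or.inr hq) m (hm.trans (le_max_right _ _)) y hy).trans_le
              (min_le_right _ _) }
  have hF : Tendsto id F (𝓝 φ) := by
    refine tendsto_smoothFun_iff.2 fun e he m K hK hKe ε hε => ?_
    refine ⟨{(e, K)}, m, ε, ⟨finite_singleton _, ?_⟩, hε, ?_⟩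
    · rintro q rfl
      exact ⟨he, hK, hKe⟩
    · intro f hf y hy
      exact hf (e, K) rfl m le_rfl y hy
  exact hF hV

variable [IsManifold I ∞ N] [I.Boundaryless]

omit [IsManifold I ∞ N] [I.Boundaryless] in
theorem tendsto_chartDeriv {e : OpenPartialHomeomorph N H} (he : e ∈ atlas H N) (m : ℕ)
    {φ : SmoothFun I N} {y : E} (hy : y ∈ (e.extend I).target) :
    Tendsto (fun f : SmoothFun I N => chartDeriv e m f y) (𝓝 φ) (𝓝 (chartDeriv e m φ y)) := by
  rw [Metric.tendsto_nhds]
  intro ε hε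
  filter_upwards [tendsto_smoothFun_iff.1 (tendsto_id (x := 𝓝 φ)) e he m {y} isCompact_singleton
    (singleton_subset_iff.2 hy) ε hε] with f hf
  rw [dist_eq_norm]
  exact hf y rfl

omit [IsManifold I ∞ N] [I.Boundaryless] in
theorem chartDeriv_zero_apply (e : OpenPartialHomeomorph N H) (f : SmoothFun I N) (y : E)
    (v : Fin 0 → E) : chartDeriv e 0 f y v = f ((e.extend I).symm y) := by
  simp [chartDeriv, iteratedFDeriv_zero_apply]

omit [IsManifold I ∞ N] [I.Boundaryless] in
theorem continuous_eval (x : N) : Continuous fun f : SmoothFun I N => f x := by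
  refine continuous_iff_continuousAt.2 fun φ => ?_
  have hx : (chartAt H x).extend I x ∈ ((chartAt H x).extend I).target :=
    ((chartAt H x).extend I).map_source (by simp)
  have h := tendsto_chartDeriv (chart_mem_atlas H x) 0 (φ := φ) hx
  have h2 := (ContinuousMultilinearMap.apply ℝ (fun _ : Fin 0 => E) ℝ ![]).continuous.continuousAt.tendsto.comp h
  simp only [Function.comp_def, ContinuousMultilinearMap.apply_apply, chartDeriv_zero_apply] at h2
  rwa [(chartAt H x).extend_left_inv (mem_chart_source H x)] at h2

/-- The derivatives of a function depend jointly continuously on the function and the point. -/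
theorem continuousOn_chartDeriv_uncurry [FiniteDimensional ℝ E] {X : Type*} [TopologicalSpace X]
    {G : X → SmoothFun I N} (hG : Continuous G) {e : OpenPartialHomeomorph N H}
    (he : e ∈ atlas H N) (m : ℕ) :
    ContinuousOn (fun q : X × E => chartDeriv e m (G q.1) q.2) (univ ×ˢ (e.extend I).target) := by
  rintro ⟨x, y⟩ ⟨-, hy⟩
  refine ContinuousAt.continuousWithinAt ?_
  obtain ⟨K, hK, hKe, hKc⟩ := local_compact_nhds (e.isOpen_extend_target.mem_nhds hy)
  rw [ContinuousAt, Metric.tendsto_nhds]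
  intro ε hε
  have h1 := tendsto_smoothFun_iff.1 (hG.tendsto x) e he m K hKc hKe (ε / 2) (half_pos hε)
  have h2 : ∀ᶠ z in 𝓝 y, dist (chartDeriv e m (G x) z) (chartDeriv e m (G x) y) < ε / 2 :=
    Metric.tendsto_nhds.1 (((contDiffOn_chartDeriv he m (G x)).continuousOn.continuousAt
      (e.isOpen_extend_target.mem_nhds hy)).tendsto) _ (half_pos hε)
  rw [nhds_prod_eq]
  filter_upwards [h1.prod_mk (h2.and hK)] with q hq
  have h3 := hq.1 q.2 hq.2.2
  rw [← dist_eq_norm] at h3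
  calc _ ≤ _ + _ := dist_triangle _ (chartDeriv e m (G x) q.2) _
    _ < ε / 2 + ε / 2 := add_lt_add h3 hq.2.1
    _ = ε := add_halves ε

/-- Affine maps from a finite-dimensional space to `C^∞(N)` are continuous. -/
theorem continuous_add_linearMap [FiniteDimensional ℝ E] {A : Type*} [NormedAddCommGroup A]
    [NormedSpace ℝ A] [FiniteDimensional ℝ A] (φ : SmoothFun I N) (L : A →ₗ[ℝ] SmoothFun I N) :
    Continuous fun a => φ + L a := by
  refine continuous_iff_continuousAt.2 fun a => tendsto_smoothFun_iff.2 ?_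
  intro e he m K hK hKe ε hε
  let b := Module.finBasis ℝ A
  have hb : ∀ i, ∃ C, ∀ y ∈ K, ‖chartDeriv e m (L (b i)) y‖ ≤ C := fun i =>
    hK.exists_bound_of_continuousOn ((contDiffOn_chartDeriv he m _).continuousOn.mono hKe)
  choose C hC using hb
  have hcont : Continuous fun a' : A => ∑ i, |b.repr (a' - a) i| * |C i| := by
    refine continuous_finsetSum _ fun i _ => ?_
    have : Continuous fun h : A => b.repr h i := (b.coord i).continuous_of_finiteDimensional
    fun_prop
  have h0 : Tendsto (fun a' : A => ∑ i, |b.repr (a' - a) i| * |C i|) (𝓝 a) (𝓝 0) := by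
    simpa using hcont.tendsto a
  filter_upwards [h0.eventually (gt_mem_nhds hε)] with a' ha' y hy
  rw [← chartDeriv_sub he m _ _ (hKe hy), add_sub_add_left_eq_sub, ← map_sub]
  have h1 : L (a' - a) = ∑ i, b.repr (a' - a) i • L (b i) := by
    conv_lhs => rw [← b.sum_repr (a' - a)]
    simp
  rw [h1, chartDeriv_sum he m _ _ (hKe hy)]
  refine (norm_sum_le _ _).trans_lt (lt_of_le_of_lt (Finset.sum_le_sum fun i _ => ?_) ha')
  rw [chartDeriv_smul he m _ _ (hKe hy), norm_smul, Real.norm_eq_abs]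
  gcongr
  exact (hC i y hy).trans (le_abs_self _)

end Manifold

/-! ### Extension by zero from charts, and jets as classes modulo powers of the vanishing ideal. -/

section Lift

variable {E : Type*} [NormedAddCommGroup E] [NormedSpace ℝ E] {H : Type*} [TopologicalSpace H]
  {I : ModelWithCorners ℝ E H} {N : Type*} [TopologicalSpace N] [ChartedSpace H N]

/-- A cutoff function supported in the domain of a chart. -/
structure IsChartCutoff (I : ModelWithCorners ℝ E H) (e : OpenPartialHomeomorph N H)
    (η : E → ℝ) : Prop where
  contDiff : ContDiff ℝ ∞ η
  isCompact_tsupport : IsCompact (tsupport η)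
  tsupport_subset : tsupport η ⊆ (e.extend I).target

variable (I) in
/-- The extension by zero of a function given in a chart. -/
def chartExtend (e : OpenPartialHomeomorph N H) (h : E → ℝ) : N → ℝ :=
  e.source.indicator (h ∘ e.extend I)

omit [ChartedSpace H N] in
theorem chartExtend_of_mem {e : OpenPartialHomeomorph N H} {x : N} (hx : x ∈ e.source)
    (h : E → ℝ) : chartExtend I e h x = h (e.extend I x) :=
  indicator_of_mem hx _

omit [ChartedSpace H N] in
theorem IsChartCutoff.isClosed_image [T2Space N] {e : OpenPartialHomeomorph N H} {η : E → ℝ}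
    (hη : IsChartCutoff I e η) : IsClosed ((e.extend I).symm '' tsupport η) :=
  (hη.isCompact_tsupport.image_of_continuousOn
    (e.continuousOn_extend_symm.mono hη.tsupport_subset)).isClosed

omit [ChartedSpace H N] in
theorem chartExtend_of_notMem {e : OpenPartialHomeomorph N H} {η : E → ℝ} {x : N}
    (hx : x ∉ (e.extend I).symm '' tsupport η) : chartExtend I e η x = 0 := by
  refine indicator_apply_eq_zero.2 fun hxe =>
    image_eq_zero_of_notMem_tsupport (f := η) (x := e.extend I x) fun h => hx ?_
  exact ⟨_, h, e.extend_left_inv hxe⟩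

omit [ChartedSpace H N] in
theorem IsChartCutoff.mul {e : OpenPartialHomeomorph N H} {η : E → ℝ} (hη : IsChartCutoff I e η)
    {h : E → ℝ} (hh : ContDiffOn ℝ ∞ h (e.extend I).target) [I.Boundaryless] :
    IsChartCutoff I e (fun y => η y * h y) := by
  have hsub : tsupport (fun y => η y * h y) ⊆ tsupport η := tsupport_mul_subset_left
  refine ⟨contDiff_iff_contDiffAt.2 fun y => ?_,
    hη.isCompact_tsupport.of_isClosed_subset (isClosed_tsupport _) hsub,
    hsub.trans hη.tsupport_subset⟩
  by_cases hy : y ∈ tsupport η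
  · exact hη.contDiff.contDiffAt.mul
      (hh.contDiffAt (e.isOpen_extend_target.mem_nhds (hη.tsupport_subset hy)))
  · refine (contDiffAt_const (c := (0 : ℝ))).congr_of_eventuallyEq ?_
    filter_upwards [(isClosed_tsupport η).isOpen_compl.mem_nhds hy] with w hw
    rw [image_eq_zero_of_notMem_tsupport hw, zero_mul]

variable [IsManifold I ∞ N] [T2Space N]

/-- In a Hausdorff space the compact image of the support is closed, so its complement and the chart
domain are two open sets covering `N`; on the first the function is zero. -/
theorem contMDiff_chartExtend {e : OpenPartialHomeomorph N H} (he : e ∈ atlas H N) {η : E → ℝ}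
    (hη : IsChartCutoff I e η) : ContMDiff I 𝓘(ℝ, ℝ) ∞ (chartExtend I e η) := by
  intro x
  by_cases hx : x ∈ e.source
  · have h1 : ContMDiffAt I 𝓘(ℝ, ℝ) ∞ (η ∘ e.extend I) x :=
      hη.contDiff.contMDiff.contMDiffAt.comp x
        ((e.contMDiffOn_extend (IsManifold.subset_maximalAtlas he)).contMDiffAt
          (e.open_source.mem_nhds hx))
    refine h1.congr_of_eventuallyEq ?_
    filter_upwards [e.open_source.mem_nhds hx] with z hz using chartExtend_of_mem hz η
  · have hx' : x ∉ (e.extend I).symm '' tsupport η := by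
      rintro ⟨y, hy, rfl⟩
      have := (e.extend I).map_target (hη.tsupport_subset hy)
      rw [e.extend_source] at this
      exact hx this
    refine (contMDiffAt_const (c := (0 : ℝ))).congr_of_eventuallyEq ?_
    filter_upwards [hη.isClosed_image.isOpen_compl.mem_nhds hx'] with z hz
    exact chartExtend_of_notMem hz

variable [I.Boundaryless] {e : OpenPartialHomeomorph N H} (he : e ∈ atlas H N)

/-- Extension by zero of a smooth function supported in a chart, as an element of `C^∞(N)`. -/
def chartLift {η : E → ℝ} (hη : IsChartCutoff I e η) : SmoothFun I N :=
  ⟨chartExtend I e η, contMDiff_chartExtend he hη⟩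

omit [I.Boundaryless] in
theorem chartLift_comp_symm {η : E → ℝ} (hη : IsChartCutoff I e η) {y : E}
    (hy : y ∈ (e.extend I).target) : chartLift he hη ((e.extend I).symm y) = η y := by
  have h1 := (e.extend I).map_target hy
  rw [e.extend_source] at h1
  change chartExtend I e η _ = _
  rw [chartExtend_of_mem h1, (e.extend I).right_inv hy]

omit [I.Boundaryless] in
theorem chartLift_eventuallyEq_zero {η : E → ℝ} (hη : IsChartCutoff I e η) {x : N}
    (hx : x ∉ (e.extend I).symm '' tsupport η) : chartLift he hη =ᶠ[𝓝 x] 0 := by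
  filter_upwards [hη.isClosed_image.isOpen_compl.mem_nhds hx] with z hz
  exact chartExtend_of_notMem hz

/-- Multiplication by a cutoff function and extension by zero, as a linear map. -/
def cutoffLift {η : E → ℝ} (hη : IsChartCutoff I e η) :
    smoothSubmodule E →ₗ[ℝ] SmoothFun I N where
  toFun h := chartLift he (hη.mul (ContDiff.contDiffOn h.2))
  map_add' h h' := by
    ext x
    change chartExtend I e _ x = chartExtend I e _ x + chartExtend I e _ x
    by_cases hx : x ∈ e.source
    · simp only [chartExtend_of_mem hx]
      exact mul_add _ _ _
    · simp [chartExtend, hx]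
  map_smul' c h := by
    ext x
    change chartExtend I e _ x = c * chartExtend I e _ x
    by_cases hx : x ∈ e.source
    · simp only [chartExtend_of_mem hx]
      exact mul_left_comm _ _ _
    · simp [chartExtend, hx]

/-- Extension by zero is bounded in `C^p`, as measured in another chart. -/
theorem exists_bound_chartDeriv_chartLift {e' : OpenPartialHomeomorph N H} (he' : e' ∈ atlas H N)
    {K : Set E} (hK : IsCompact K) (hKe : K ⊆ (e'.extend I).target) {B : Set E} (hB : IsCompact B)
    (hBe : B ⊆ (e.extend I).target) (p : ℕ) :
    ∃ C, 0 ≤ C ∧ ∀ (η : E → ℝ) (hη : IsChartCutoff I e η), tsupport η ⊆ B → ∀ A, 0 ≤ A →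
      (∀ j ≤ p, ∀ z, ‖iteratedFDeriv ℝ j η z‖ ≤ A) →
      ∀ m ≤ p, ∀ y ∈ K, ‖chartDeriv e' m (chartLift he hη) y‖ ≤ C * A := by
  have hBN : IsCompact ((e.extend I).symm '' B) :=
    hB.image_of_continuousOn (e.continuousOn_extend_symm.mono hBe)
  -- Only on this compact part of `K` can a lift with support in `B` be nonzero nearby; it lies in
  -- the overlap, where the transition map has bounded derivatives.
  set K' := K ∩ (e'.extend I).symm ⁻¹' ((e.extend I).symm '' B) with hK'def
  have hK' : IsCompact K' := by
    refine hK.of_isClosed_subset ?_ inter_subset_left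
    exact (e'.continuousOn_extend_symm.mono hKe).preimage_isClosed_of_isClosed hK.isClosed
      hBN.isClosed
  set σ := e.extend I ∘ (e'.extend I).symm with hσ
  set O := (e'.extend I).target ∩ (e'.extend I).symm ⁻¹' e.source with hO
  have hOo : IsOpen O := isOpen_chart_overlap e' e
  have hσO : ContDiffOn ℝ ∞ σ O := contDiffOn_chart_transition he' he
  have hK'O : K' ⊆ O := by
    rintro y ⟨hy, z, hz, hzy⟩
    refine ⟨hKe hy, ?_⟩
    rw [mem_preimage, ← hzy, ← e.extend_source (I := I)]
    exact (e.extend I).map_target (hBe hz)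
  have hD : ∀ i : ℕ, ∃ D, ∀ y ∈ K', ‖iteratedFDerivWithin ℝ i σ O y‖ ≤ D := fun i =>
    hK'.exists_bound_of_continuousOn
      ((hσO.continuousOn_iteratedFDerivWithin (by exact_mod_cast le_top)
        hOo.uniqueDiffOn).mono hK'O)
  choose D hD using hD
  -- The estimate for composites asks for `‖Dⁱσ‖ ≤ D' ^ i` with `i ≥ 1`; one `D' ≥ 1` above all the
  -- `D i` serves for every `i`.
  set D' : ℝ := 1 + ∑ i ∈ Finset.range (p + 1), |D i| with hD'
  have hD'1 : 1 ≤ D' := by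
    have : 0 ≤ ∑ i ∈ Finset.range (p + 1), |D i| := Finset.sum_nonneg fun _ _ => abs_nonneg _
    linarith
  have hDD' : ∀ i ≤ p, D i ≤ D' := by
    intro i hi
    have := Finset.single_le_sum (f := fun i => |D i|) (fun i _ => abs_nonneg _)
      (Finset.mem_range.2 (Nat.lt_succ_of_le hi))
    have h2 := le_abs_self (D i)
    linarith
  refine ⟨p.factorial * D' ^ p, by positivity, fun η hη hηB A hA hηA m hm y hy => ?_⟩
  by_cases hyK' : y ∈ K'
  · have h1 : chartLift he hη ∘ (e'.extend I).symm =ᶠ[𝓝 y] η ∘ σ := by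
      filter_upwards [hOo.mem_nhds (hK'O hyK')] with z hz
      exact chartExtend_of_mem hz.2 η
    have h2 : chartDeriv e' m (chartLift he hη) y = iteratedFDerivWithin ℝ m (η ∘ σ) O y := by
      rw [iteratedFDerivWithin_of_isOpen m hOo (hK'O hyK')]
      exact (h1.iteratedFDeriv ℝ m).eq_of_nhds
    rw [h2]
    refine (norm_iteratedFDerivWithin_comp_le (N := ∞) (C := A) (D := D') hη.contDiff.contDiffOn
      hσO (by exact_mod_cast le_top) uniqueDiffOn_univ hOo.uniqueDiffOn (mapsTo_univ _ _)
      (hK'O hyK') ?_ ?_).trans ?_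
    · intro i hi
      rw [iteratedFDerivWithin_univ]
      exact hηA i (hi.trans hm) _
    · intro i hi1 hi
      exact ((hD i y hyK').trans (hDD' i (hi.trans hm))).trans
        (le_self_pow₀ hD'1 (by omega))
    · rw [mul_right_comm]
      gcongr
  · have h0 : (e'.extend I).symm y ∉ (e.extend I).symm '' tsupport η := fun h =>
      hyK' ⟨hy, image_mono hηB h⟩
    have h1 : chartDeriv e' m (chartLift he hη) y = 0 := by
      rw [chartDeriv_congr e' m (g := 0) (hKe hy) (chartLift_eventuallyEq_zero he hη h0)]
      have := chartDeriv_sub he' m (0 : SmoothFun I N) 0 (hKe hy)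
      rwa [sub_self, sub_self] at this
    rw [h1, norm_zero]
    positivity

omit [T2Space N] in
theorem norm_chartDeriv_mul_le (he : e ∈ atlas H N) (f g : SmoothFun I N) {y : E}
    (hy : y ∈ (e.extend I).target) (n : ℕ) :
    ‖chartDeriv e n (f * g) y‖ ≤ ∑ i ∈ Finset.range (n + 1),
      (n.choose i : ℝ) * ‖chartDeriv e i f y‖ * ‖chartDeriv e (n - i) g y‖ := by
  have hO := e.isOpen_extend_target (I := I)
  have h := norm_iteratedFDerivWithin_mul_le (contDiffOn_chart he f) (contDiffOn_chart he g)
    hO.uniqueDiffOn hy (n := n) (by exact_mod_cast le_top)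
  simp only [iteratedFDerivWithin_of_isOpen _ hO hy] at h
  exact h

omit [T2Space N] in
/-- Functions in the `n`-th power of the vanishing ideal of a point have vanishing derivatives of
order less than `n` there. -/
theorem chartDeriv_eq_zero_of_mem_pow (he : e ∈ atlas H N) {x : N} (hx : x ∈ e.source) (n : ℕ)
    {f : SmoothFun I N} (hf : f ∈ vanishingIdeal I x ^ n) (m : ℕ) (hm : m < n) :
    chartDeriv e m f (e.extend I x) = 0 := by
  have hy : e.extend I x ∈ (e.extend I).target :=
    (e.extend I).map_source (by rwa [e.extend_source])
  -- By Leibniz, functions with vanishing derivatives of order `< n` form an ideal, and multiplying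
  -- by a function that vanishes at `x` passes from `n` to `n + 1`: the `i = 0` term contains its
  -- value, the other terms fewer than `n` derivatives of the other factor.
  let Z : ℕ → Ideal (SmoothFun I N) := fun n =>
    { carrier := {f | ∀ m < n, chartDeriv e m f (e.extend I x) = 0}
      add_mem' := fun {f g} hf hg m hm => by
        rw [chartDeriv_add he m f g hy, hf m hm, hg m hm, add_zero]
      zero_mem' := fun m _ => by
        have := chartDeriv_sub he m (0 : SmoothFun I N) 0 hy
        rwa [sub_self, sub_self] at this
      smul_mem' := fun g f hf m hm => by
        refine norm_le_zero_iff.1 ((norm_chartDeriv_mul_le he g f hy m).trans ?_)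
        refine (Finset.sum_eq_zero fun i _ => ?_).le
        rw [hf (m - i) (by omega), norm_zero, mul_zero] }
  have key : ∀ n, vanishingIdeal I x ^ n ≤ Z n := by
    intro n
    induction n with
    | zero => exact fun f _ m hm => absurd hm (Nat.not_lt_zero m)
    | succ n ih =>
      rw [pow_succ']
      refine Ideal.mul_le.2 fun f hf g hg m (hm' : m < n + 1) => ?_
      refine norm_le_zero_iff.1 ((norm_chartDeriv_mul_le he f g hy m).trans ?_)
      refine (Finset.sum_eq_zero fun i hi' => ?_).le
      have hi'' := Finset.mem_range.1 hi'
      rcases Nat.eq_zero_or_pos i with rfl | hi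
      · have h0 : chartDeriv e 0 f (e.extend I x) = 0 := by
          ext v
          rw [chartDeriv_zero_apply, e.extend_left_inv hx]
          exact hf
        rw [h0, norm_zero, mul_zero, zero_mul]
      · rw [ih hg (m - i) (by omega), norm_zero, mul_zero]
  exact key n hf m hm

-- This lets coordinates of a jet be computed from any representative of its class. Only this
-- direction is needed to define functions on the jet bundle through coordinates.
omit [T2Space N] in
theorem jetCoord_eq_of_jet_eq (he : e ∈ atlas H N) {x : N} (hx : x ∈ e.source) {p : ℕ}
    {f g : SmoothFun I N} (h : jet p x f = jet p x g) : jetCoord e p x f = jetCoord e p x g := by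
  have hy : e.extend I x ∈ (e.extend I).target :=
    (e.extend I).map_source (by rwa [e.extend_source])
  funext j
  have h1 := chartDeriv_eq_zero_of_mem_pow he hx (p + 1) (Ideal.Quotient.eq.1 h) j j.2
  rw [chartDeriv_sub he _ _ _ hy] at h1
  exact sub_eq_zero.1 h1

end Lift

/-! ### Finite order of local maps. -/

section Order

variable {E : Type*} [NormedAddCommGroup E] [NormedSpace ℝ E] {H : Type*} [TopologicalSpace H]
  {I : ModelWithCorners ℝ E H} {N : Type*} [TopologicalSpace N] [ChartedSpace H N]

/-- A linear functional commutes with difference quotients, so statements on the Gateaux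
differential reduce to real functions of one variable. -/
theorem HasGateauxDeriv.hasDerivAt {V W : Type*} [AddCommGroup V] [Module ℝ V]
    [AddCommGroup W] [Module ℝ W] [TopologicalSpace W] {f : V → W} {x v : V} {y : W}
    (h : HasGateauxDeriv f x v y) (l : W →ₗ[ℝ] ℝ) (hl : ContinuousAt l y) :
    HasDerivAt (fun t : ℝ => l (f (x + t • v))) (l y) 0 := by
  rw [hasDerivAt_iff_tendsto_slope_zero]
  refine (hl.tendsto.comp h).congr fun t => ?_
  simp

/-- Evaluation at a point, as a linear map. -/
def evalLinear (x : N) : SmoothFun I N →ₗ[ℝ] ℝ where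
  toFun f := f x
  map_add' _ _ := rfl
  map_smul' _ _ := rfl

theorem HasGateauxDeriv.hasDerivAt_eval {V : Type*} [AddCommGroup V] [Module ℝ V]
    {f : V → SmoothFun I N} {z v : V} {y : SmoothFun I N} (t : ℝ)
    (h : HasGateauxDeriv f (z + t • v) v y) (x : N) :
    HasDerivAt (fun t : ℝ => f (z + t • v) x) (y x) t := by
  have h1 := h.hasDerivAt (evalLinear x) (continuous_eval x).continuousAt
  have h2 : HasDerivAt (fun s : ℝ => f (z + t • v + s • v) x) (y x) (t - t) := by
    rw [sub_self]; exact h1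
  refine (h2.comp_sub_const t t).congr_of_eventuallyEq (Eventually.of_forall fun s => ?_)
  simp only [sub_smul]
  congr 2
  abel

/-- The topology only controls compact sets lying inside charts; the compactness of `K` cuts it into
finitely many such pieces. -/
theorem eventually_nhds_zero_abs_lt_one [IsManifold I ∞ N] [I.Boundaryless]
    [FiniteDimensional ℝ E] {K : Set N} (hK : IsCompact K) :
    ∀ᶠ g : SmoothFun I N in 𝓝 0, ∀ x ∈ K, |g x| < 1 := by
  refine hK.induction_on (p := fun S => ∀ᶠ g : SmoothFun I N in 𝓝 0, ∀ x ∈ S, |g x| < 1)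
    (by simp) (fun S S' hS h => h.mono fun g hg x hx => hg x (hS hx))
    (fun S S' h h' => (h.and h').mono fun g hg x hx => hx.elim (hg.1 x) (hg.2 x)) fun x _ => ?_
  set e := chartAt H x
  have hx : x ∈ e.source := mem_chart_source H x
  have hy : e.extend I x ∈ (e.extend I).target :=
    (e.extend I).map_source (by rwa [e.extend_source])
  obtain ⟨B, hB, hBe, hBc⟩ := local_compact_nhds (e.isOpen_extend_target.mem_nhds hy)
  refine ⟨e.source ∩ e.extend I ⁻¹' B, mem_nhdsWithin_of_mem_nhds (inter_mem
    (e.open_source.mem_nhds hx) ((e.continuousAt_extend hx).preimage_mem_nhds hB)), ?_⟩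
  filter_upwards [tendsto_smoothFun_iff.1 (tendsto_id (x := 𝓝 (0 : SmoothFun I N))) e
    (chart_mem_atlas H x) 0 B hBc hBe 1 one_pos] with g hg z hz
  have h1 := hg _ hz.2
  rw [id, ← chartDeriv_sub (chart_mem_atlas H x) _ _ _ (hBe hz.2), sub_zero] at h1
  have h2 := (chartDeriv e 0 g (e.extend I z)).le_opNorm ![]
  rw [chartDeriv_zero_apply, e.extend_left_inv hz.1] at h2
  simp only [Finset.univ_eq_empty, Finset.prod_empty, mul_one] at h2
  exact h2.trans_lt h1

variable [IsManifold I ∞ N] [I.Boundaryless]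

/-- Convexity of the ball: the segment used in the integration argument does not leave the region
where the differential is controlled. -/
theorem jetBall_segment {T : Set (OpenPartialHomeomorph N H × Set E)} (hT : IsCompactFamily I T)
    {p : ℕ} {ε : ℝ} {φ f g : SmoothFun I N} (hf : f ∈ jetBall T p ε φ) (hg : g ∈ jetBall T p ε φ)
    {t : ℝ} (ht : t ∈ Icc (0 : ℝ) 1) : f + t • (g - f) ∈ jetBall T p ε φ := by
  intro q hq m hm y hy
  have hqe := (hT.2 q hq).1
  have hy' := (hT.2 q hq).2.2 hy
  have h1 := hf q hq m hm y hy
  have h2 := hg q hq m hm y hy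
  rw [← mem_ball_iff_norm] at h1 h2 ⊢
  rw [chartDeriv_add hqe _ _ _ hy', chartDeriv_smul hqe _ _ _ hy', chartDeriv_sub hqe _ _ _ hy']
  exact (convex_ball _ _).add_smul_sub_mem h1 h2 ht

variable [T2Space N] [FiniteDimensional ℝ E]

omit [ChartedSpace H N] [IsManifold I ∞ N] [I.Boundaryless] [T2Space N] in
theorem exists_chart_bump {e : OpenPartialHomeomorph N H} {y : E} {U : Set E}
    (hU : U ∈ 𝓝 y) (hUe : U ⊆ (e.extend I).target) :
    ∃ η : E → ℝ, IsChartCutoff I e η ∧ tsupport η ⊆ U ∧ ∀ᶠ z in 𝓝 y, η z = 1 := by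
  obtain ⟨δ, hδ, hball⟩ := Metric.mem_nhds_iff.1 hU
  let β : ContDiffBump (y : E) := ⟨δ / 3, δ / 2, by positivity, by linarith⟩
  have hs : tsupport β ⊆ U := by
    rw [β.tsupport_eq]
    exact (Metric.closedBall_subset_ball (by change δ / 2 < δ; linarith)).trans hball
  exact ⟨β, ⟨β.contDiff, β.hasCompactSupport, hs.trans hUe⟩, hs, β.eventuallyEq_one⟩

/-- A function whose `p`-jet at `x` vanishes coincides near `x` with a function of small support
that is small in `C^p`. -/
theorem exists_eventuallyEq_small {T : Set (OpenPartialHomeomorph N H × Set E)}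
    (hT : IsCompactFamily I T) {p : ℕ} {e : OpenPartialHomeomorph N H} (he : e ∈ atlas H N)
    {x : N} (hx : x ∈ e.source) {U : Set N} (hU : IsOpen U) (hxU : x ∈ U) {ψ : SmoothFun I N}
    (hψ : jetCoord e p x ψ = 0) {ε : ℝ} (hε : 0 < ε) :
    ∃ ψ' : SmoothFun I N, ψ' =ᶠ[𝓝 x] ψ ∧ (∀ z ∉ U, ψ' z = 0) ∧
      ∀ q ∈ T, ∀ m ≤ p, ∀ y ∈ q.2, ‖chartDeriv q.1 m ψ' y‖ < ε := by
  set y := e.extend I x with hydef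
  have hy : y ∈ (e.extend I).target := (e.extend I).map_source (by rwa [e.extend_source])
  have hsymm : (e.extend I).symm y = x := e.extend_left_inv hx
  set O := (e.extend I).target ∩ (e.extend I).symm ⁻¹' U with hO
  have hOo : IsOpen O := e.continuousOn_extend_symm.isOpen_inter_preimage e.isOpen_extend_target hU
  have hyO : y ∈ O := ⟨hy, by rwa [mem_preimage, hsymm]⟩
  -- The factor `η` replaces `ψ`, read in the chart, by a function smooth on all of `E` with the
  -- same germ at `y`, as the cutoff lemma requires.
  obtain ⟨η, hη, -, hη1⟩ := exists_chart_bump (I := I) (e.isOpen_extend_target.mem_nhds hy)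
    Subset.rfl
  obtain ⟨δ, hδ, hδO⟩ := Metric.nhds_basis_closedBall.mem_iff.1 (hOo.mem_nhds hyO)
  have hBe : Metric.closedBall y δ ⊆ (e.extend I).target := hδO.trans inter_subset_left
  have hC : ∀ q ∈ T, ∃ C, 0 ≤ C ∧ ∀ (η : E → ℝ) (hη : IsChartCutoff I e η),
      tsupport η ⊆ Metric.closedBall y δ → ∀ A, 0 ≤ A →
      (∀ j ≤ p, ∀ z, ‖iteratedFDeriv ℝ j η z‖ ≤ A) →
      ∀ m ≤ p, ∀ z ∈ q.2, ‖chartDeriv q.1 m (chartLift he hη) z‖ ≤ C * A := fun q hq =>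
    exists_bound_chartDeriv_chartLift he (hT.2 q hq).1 (hT.2 q hq).2.1 (hT.2 q hq).2.2
      (isCompact_closedBall y δ) hBe p
  choose! C hC0 hC using hC
  obtain ⟨A, hA0, hA⟩ : ∃ A : ℝ, 0 < A ∧ ∀ q ∈ T, C q * A < ε := by
    have h1 : ∀ᶠ A : ℝ in 𝓝[>] 0, ∀ q ∈ T, C q * A < ε := by
      refine (eventually_all_finite hT.1).2 fun q _ => ?_
      have : Tendsto (fun A : ℝ => C q * A) (𝓝[>] 0) (𝓝 (C q * 0)) :=
        ((continuous_const.mul continuous_id).tendsto 0).mono_left nhdsWithin_le_nhds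
      rw [mul_zero] at this
      exact this.eventually (gt_mem_nhds hε)
    obtain ⟨A, hA, hA'⟩ := (h1.and self_mem_nhdsWithin).exists
    exact ⟨A, hA', hA⟩
  have hh := hη.mul (contDiffOn_chart he ψ)
  have hflat : ∀ j ≤ p, iteratedFDeriv ℝ j
      (fun z => η z * (ψ ∘ (e.extend I).symm) z) y = 0 := by
    intro j hj
    have h1 : (fun z => η z * (ψ ∘ (e.extend I).symm) z) =ᶠ[𝓝 y] ψ ∘ (e.extend I).symm := by
      filter_upwards [hη1] with z hz
      rw [hz, one_mul]
    rw [(h1.iteratedFDeriv ℝ j).eq_of_nhds]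
    exact congrFun hψ ⟨j, Nat.lt_succ_of_le hj⟩
  obtain ⟨ρ, hρ, hρs, hρ1, hρb⟩ := exists_cutoff_of_flat hh.contDiff hflat hδ hA0
  have hρc : IsChartCutoff I e ρ := ⟨hρ, (isCompact_closedBall y δ).of_isClosed_subset
    (isClosed_tsupport _) hρs, hρs.trans hBe⟩
  have hs := hρc.mul hh.contDiff.contDiffOn
  have hss := (tsupport_mul_subset_left (f := ρ)
    (g := fun z => η z * (ψ ∘ (e.extend I).symm) z)).trans hρs
  refine ⟨chartLift he hs, ?_, ?_, ?_⟩
  · have h1 : ∀ᶠ z in 𝓝 x, ρ (e.extend I z) = 1 ∧ η (e.extend I z) = 1 :=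
      (e.continuousAt_extend hx).eventually (hρ1.and hη1)
    filter_upwards [h1, e.open_source.mem_nhds hx] with z hz hze
    change chartExtend I e _ z = _
    rw [chartExtend_of_mem hze, hz.1, hz.2, one_mul, one_mul, Function.comp_apply,
      e.extend_left_inv hze]
  · intro z hz
    refine chartExtend_of_notMem fun ⟨w, hw, hwz⟩ => hz ?_
    rw [← hwz]
    exact (hδO (hss hw)).2
  · intro q hq m hm z hz
    exact (hC q hq _ hs hss A hA0.le hρb m hm z hz).trans_lt (hA q hq)

/-- Distinct points have disjoint neighbourhoods, so the one-point solutions supported there can be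
added without disturbing each other's germs. The bound `ε / (k + 1)` also covers `k = 0`. -/
theorem exists_eventuallyEq_small_of_injective {T : Set (OpenPartialHomeomorph N H × Set E)}
    (hT : IsCompactFamily I T) {p k : ℕ} {e : Fin k → OpenPartialHomeomorph N H}
    (he : ∀ i, e i ∈ atlas H N) {x : Fin k → N} (hinj : Function.Injective x)
    (hx : ∀ i, x i ∈ (e i).source) {ψ : SmoothFun I N}
    (hψ : ∀ i, jetCoord (e i) p (x i) ψ = 0) {ε : ℝ} (hε : 0 < ε) :
    ∃ ψ' : SmoothFun I N, (∀ᶠ z in 𝓝ˢ (range x), ψ' z = ψ z) ∧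
      ∀ q ∈ T, ∀ m ≤ p, ∀ y ∈ q.2, ‖chartDeriv q.1 m ψ' y‖ < ε := by
  obtain ⟨U, hU, hdisj⟩ := (finite_range x).t2_separation
  have hk : 0 < ε / (k + 1) := by positivity
  choose ψ' h1 h2 h3 using fun i =>
    exists_eventuallyEq_small hT (he i) (hx i) (hU (x i)).2 (hU (x i)).1 (hψ i) hk
  refine ⟨∑ i, ψ' i, ?_, fun q hq m hm y hy => ?_⟩
  · rw [eventually_nhdsSet_iff_forall]
    rintro _ ⟨i, rfl⟩
    filter_upwards [h1 i, (hU (x i)).2.mem_nhds (hU (x i)).1] with z hz hzU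
    have h4 : (∑ j, ψ' j) z = ∑ j, ψ' j z := map_sum (evalLinear z) ψ' Finset.univ
    rw [h4, Finset.sum_eq_single i, hz]
    · intro j _ hji
      refine h2 j z fun hzj => ?_
      exact (hdisj (mem_range_self j) (mem_range_self i) (hinj.ne hji)).le_bot ⟨hzj, hzU⟩
    · simp
  · rw [chartDeriv_sum (hT.2 q hq).1 _ _ _ ((hT.2 q hq).2.2 hy)]
    refine (norm_sum_le _ _).trans_lt ?_
    calc ∑ i, ‖chartDeriv q.1 m (ψ' i) y‖ ≤ ∑ _i : Fin k, ε / (k + 1) :=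
          Finset.sum_le_sum fun i _ => (h3 i q hq m hm y hy).le
      _ = ε * (k / (k + 1)) := by
          rw [Finset.sum_const, Finset.card_univ, Fintype.card_fin, nsmul_eq_mul]
          ring
      _ < ε := by
          refine mul_lt_of_lt_one_right hε ?_
          rw [div_lt_one (by positivity)]
          linarith

/-- A Bastiani smooth multilocal map depends, locally in `C^∞(N)` and uniformly on compact sets,
only on jets of a fixed finite order. -/
theorem exists_order {k : ℕ} {F : SmoothFun I N → SmoothFunPow I N k} (hF : IsBastianiSmooth F)
    (hloc : IsMultilocal F) (φ : SmoothFun I N) {K : Set (Fin k → N)} (hK : IsCompact K) :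
    ∃ (T : Set (OpenPartialHomeomorph N H × Set E)) (p : ℕ) (ε : ℝ), IsCompactFamily I T ∧ 0 < ε ∧
      ∀ f ∈ jetBall T p ε φ, ∀ g ∈ jetBall T p ε φ, ∀ x ∈ K, Function.Injective x →
        ∀ e : Fin k → OpenPartialHomeomorph N H, (∀ i, e i ∈ atlas H N) →
        (∀ i, x i ∈ (e i).source) → (∀ i, jetCoord (e i) p (x i) f = jetCoord (e i) p (x i) g) →
        F f x = F g x := by
  obtain ⟨D, hD0, hD, hDc⟩ := hF
  have hFD : (fun z => D 0 z ![]) = F := funext fun z => hD0 z ![]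
  have hder : ∀ (z v : SmoothFun I N) (x : Fin k → N) (t : ℝ),
      HasDerivAt (fun t : ℝ => F (z + t • v) x) (D 1 (z + t • v) (Fin.cons v ![]) x) t := by
    intro z v x t
    have h1 := hD 0 (z + t • v) ![] v
    rw [hFD] at h1
    exact h1.hasDerivAt_eval t x
  have hder0 : ∀ (z v : SmoothFun I N) (x : Fin k → N),
      HasDerivAt (fun t : ℝ => F (z + t • v) x) (D 1 z (Fin.cons v ![]) x) 0 := by
    intro z v x
    have := hder z v x 0
    rwa [zero_smul, add_zero] at this
  have hzero : D 1 φ (Fin.cons 0 ![]) = 0 := by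
    ext x
    have h1 := hder0 φ 0 x
    simp only [smul_zero, add_zero] at h1
    exact h1.unique (hasDerivAt_const 0 _)
  have hcont : Continuous fun q : SmoothFun I N × SmoothFun I N =>
      D 1 q.1 (Fin.cons q.2 ![]) := by
    refine (hDc 1).comp (continuous_fst.prodMk (continuous_pi fun i => ?_))
    have : i = 0 := Subsingleton.elim _ _
    subst this
    exact continuous_snd
  -- Continuity of `DF` at `(φ, 0)`, uniformly over `K`. The neighbourhood of `0` obtained here
  -- contains a ball of some finite order `p₂`, which is where the order of the jets comes from.
  have hev : ∀ᶠ q : SmoothFun I N × SmoothFun I N in 𝓝 φ ×ˢ 𝓝 0, ∀ x ∈ K,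
      |D 1 q.1 (Fin.cons q.2 ![]) x| < 1 := by
    rw [← nhds_prod_eq]
    have h1 := hcont.tendsto (φ, 0)
    simp only [hzero] at h1
    exact h1.eventually (p := fun g : SmoothFunPow I N k => ∀ x ∈ K, |g x| < 1)
      (eventually_nhds_zero_abs_lt_one hK)
  obtain ⟨P, hP, Q, hQ, hPQ⟩ := eventually_prod_iff.1 hev
  obtain ⟨T, p₁, ε, hT, hε, hTP⟩ := exists_jetBall_subset hP
  obtain ⟨T', p₂, ε', hT', hε', hTQ⟩ := exists_jetBall_subset hQ
  refine ⟨T, max p₁ p₂, ε, hT, hε, fun f hf g hg x hx hinj e he hxe hfg => ?_⟩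
  -- If the value `d` were nonzero, `g - f` could be replaced by `ψ` with the same germs and so
  -- small that `d⁻¹ • ψ` lies in the ball where `|DF_z| < 1`; but there `DF_z` would take the value
  -- `d⁻¹ * d = 1` at `x`.
  have hvan : ∀ z : SmoothFun I N, P z → D 1 z (Fin.cons (g - f) ![]) x = 0 := by
    intro z hz
    by_contra hne
    set d := D 1 z (Fin.cons (g - f) ![]) x with hd
    have hsmall : 0 < |d| * ε' := by positivity
    have hjet : ∀ i, jetCoord (e i) p₂ (x i) (g - f) = 0 := by
      intro i
      funext j
      have hy : (e i).extend I (x i) ∈ ((e i).extend I).target :=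
        ((e i).extend I).map_source (by rw [(e i).extend_source]; exact hxe i)
      have h1 := congrFun (hfg i) ⟨j, by have := j.2; omega⟩
      change chartDeriv (e i) j (g - f) _ = 0
      rw [chartDeriv_sub (he i) _ _ _ hy, sub_eq_zero]
      exact h1.symm
    obtain ⟨ψ, hψ, hψs⟩ := exists_eventuallyEq_small_of_injective hT' he hinj hxe hjet hsmall
    have h1 : D 1 z (Fin.cons ψ ![]) x = d := by
      refine (hder0 z ψ x).unique ((hder0 z (g - f) x).congr_of_eventuallyEq ?_)
      refine Eventually.of_forall fun t => hloc x _ _ ?_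
      filter_upwards [hψ] with w hw
      change z w + t * ψ w = z w + t * (g - f) w
      rw [hw]
    -- Homogeneity of the differential is not part of the definition; it follows by reparametrizing
    -- the line.
    have h2 : D 1 z (Fin.cons (d⁻¹ • ψ) ![]) x = d⁻¹ * d := by
      have h3 : HasDerivAt (fun t : ℝ => F (z + t • ψ) x) (D 1 z (Fin.cons ψ ![]) x)
        (d⁻¹ * 0) := by rw [mul_zero]; exact hder0 z ψ x
      have h4 := h3.comp (0 : ℝ) ((hasDerivAt_id (0 : ℝ)).const_mul d⁻¹)
      rw [h1, mul_one, mul_comm] at h4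
      refine (hder0 z (d⁻¹ • ψ) x).unique (h4.congr_of_eventuallyEq ?_)
      refine Eventually.of_forall fun t => ?_
      simp only [Function.comp_apply, smul_smul, mul_comm]
    have h5 : Q (d⁻¹ • ψ) := by
      refine hTQ fun q hq m hm y hy => ?_
      have hqe := (hT'.2 q hq).1
      have hy' := (hT'.2 q hq).2.2 hy
      rw [← chartDeriv_sub hqe _ _ _ hy', sub_zero, chartDeriv_smul hqe _ _ _ hy', norm_smul,
        norm_inv, Real.norm_eq_abs, inv_mul_lt_iff₀ (abs_pos.2 hne)]
      exact hψs q hq m hm y hy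
    have h6 := hPQ hz h5 x hx
    rw [h2, inv_mul_cancel₀ hne, abs_one] at h6
    exact lt_irrefl _ h6
  have hmono : jetBall T (max p₁ p₂) ε φ ⊆ jetBall T p₁ ε φ := fun h hh q hq m hm =>
    hh q hq m (hm.trans (le_max_left _ _))
  -- Along the segment from `f` to `g` the derivative of the value at `x` is `DF(g - f)(x) = 0`.
  have hconst := constant_of_has_deriv_right_zero
    (f := fun t : ℝ => F (f + t • (g - f)) x) (a := 0) (b := 1)
    (fun t _ => (hder f (g - f) x t).continuousAt.continuousWithinAt) (fun t ht => by
      have h1 := hder f (g - f) x t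
      rw [hvan _ (hTP (jetBall_segment hT (hmono hf) (hmono hg) ⟨ht.1, ht.2.le⟩))] at h1
      exact h1.hasDerivWithinAt) 1 (by simp)
  simp only [one_smul, zero_smul, add_zero, add_sub_cancel] at hconst
  exact hconst.symm

end Order

/-! ### Finite-dimensional families of functions. -/

section Family

variable {E : Type*} [NormedAddCommGroup E] [NormedSpace ℝ E] {H : Type*} [TopologicalSpace H]
  {I : ModelWithCorners ℝ E H} {N : Type*} [TopologicalSpace N] [ChartedSpace H N]

/-- A component of a derivative at a point, as a linear map. -/
def chartDerivLinear [IsManifold I ∞ N] [I.Boundaryless] {e : OpenPartialHomeomorph N H}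
    (he : e ∈ atlas H N) (m : ℕ) {y : E} (hy : y ∈ (e.extend I).target) (w : Fin m → E) :
    SmoothFun I N →ₗ[ℝ] ℝ where
  toFun f := chartDeriv e m f y w
  map_add' f g := by rw [chartDeriv_add he m f g hy]; rfl
  map_smul' c f := by rw [chartDeriv_smul he m c f hy]; rfl

theorem hasLineDerivAt_chartDeriv [IsManifold I ∞ N] [I.Boundaryless]
    {e : OpenPartialHomeomorph N H} (he : e ∈ atlas H N) (m : ℕ) (f : SmoothFun I N) {y : E}
    (hy : y ∈ (e.extend I).target) (w : Fin m → E) (u : E) :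
    HasDerivAt (fun t : ℝ => chartDeriv e m f (y + t • u) w)
      (chartDeriv e (m + 1) f y (Fin.cons u w)) 0 := by
  have h1 : DifferentiableAt ℝ (chartDeriv e m f) y :=
    ((contDiffOn_chartDeriv he m f).contDiffAt (e.isOpen_extend_target.mem_nhds hy)).differentiableAt
      (by simp)
  have h2 := h1.hasFDerivAt.hasLineDerivAt u
  have h3 := (ContinuousMultilinearMap.apply ℝ (fun _ : Fin m => E) ℝ w).hasFDerivAt.comp_hasDerivAt
    (0 : ℝ) h2
  have h4 : chartDeriv e (m + 1) f y (Fin.cons u w) = fderiv ℝ (chartDeriv e m f) y u w := by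
    simp only [chartDeriv]
    rw [iteratedFDeriv_succ_apply_left]
    simp
  rw [h4]
  exact h3

/-- A Bastiani smooth map into `C^∞(N')` is jointly smooth along finite-dimensional families. -/
theorem IsBastianiSmooth.contDiffOn_family {E' : Type*} [NormedAddCommGroup E'] [NormedSpace ℝ E']
    [FiniteDimensional ℝ E] [FiniteDimensional ℝ E'] {H' : Type*} [TopologicalSpace H']
    {I' : ModelWithCorners ℝ E' H'} {N' : Type*} [TopologicalSpace N'] [ChartedSpace H' N']
    [IsManifold I ∞ N] [I.Boundaryless] [IsManifold I' ∞ N'] [I'.Boundaryless]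
    {F : SmoothFun I N → SmoothFun I' N'} (hF : IsBastianiSmooth F)
    {A : Type*} [NormedAddCommGroup A] [NormedSpace ℝ A] [FiniteDimensional ℝ A]
    (φ : SmoothFun I N) (L : A →ₗ[ℝ] SmoothFun I N) {e : OpenPartialHomeomorph N' H'}
    (he : e ∈ atlas H' N') :
    ContDiffOn ℝ ∞ (fun q : A × E' => F (φ + L q.1) ((e.extend I').symm q.2))
      (univ ×ˢ (e.extend I').target) := by
  obtain ⟨D, hD0, hD, hDc⟩ := hF
  -- All mixed derivatives of `F` along the family: a line derivative in a parameter direction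
  -- raises `n`, one in a point direction raises `m`. The class is therefore closed and its members
  -- are jointly continuous; `F` itself is `n = m = 0`.
  let S : Set (A × E' → ℝ) := {f | ∃ (n : ℕ) (v : Fin n → A) (m : ℕ) (w : Fin m → E'),
    f = fun q => chartDeriv e m (D n (φ + L q.1) (L ∘ v)) q.2 w}
  have hopen : IsOpen ((univ : Set A) ×ˢ (e.extend I').target) :=
    isOpen_univ.prod e.isOpen_extend_target
  refine contDiffOn_of_lineDeriv_closed
    ((Module.finBasis ℝ A).prod (Module.finBasis ℝ E')) hopen S ?_ ?_ _ ?_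
  · rintro _ ⟨n, v, m, w, rfl⟩
    have h1 : Continuous fun a => D n (φ + L a) (L ∘ v) :=
      (hDc n).comp ((continuous_add_linearMap φ L).prodMk continuous_const)
    exact (ContinuousMultilinearMap.apply ℝ (fun _ : Fin m => E') ℝ w).continuous.comp_continuousOn
      (continuousOn_chartDeriv_uncurry h1 he m)
  · rintro _ ⟨n, v, m, w, rfl⟩ (i | i)
    · set a := Module.finBasis ℝ A i
      refine ⟨_, ⟨n + 1, Fin.cons a v, m, w, rfl⟩, fun q hq => ?_⟩
      have h1 := (hD n (φ + L q.1) (L ∘ v) (L a)).hasDerivAt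
        (chartDerivLinear he m hq.2 w) ?_
      · have h2 : L ∘ (Fin.cons a v : Fin (n + 1) → A) = Fin.cons (L a) (L ∘ v) := by
          funext j
          refine Fin.cases ?_ (fun j => ?_) j <;> simp
        rw [← h2] at h1
        refine h1.congr_of_eventuallyEq (Eventually.of_forall fun t => ?_)
        simp only [Module.Basis.prod_apply_inl_fst, Prod.fst_add, Prod.snd_add, Prod.smul_fst,
          Prod.smul_snd, Module.Basis.prod_apply_inl_snd, smul_zero, add_zero, map_add, map_smul,
          add_assoc]
        rfl
      · exact (ContinuousMultilinearMap.apply ℝ (fun _ : Fin m => E') ℝ w).continuous.continuousAt.tendsto.comp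
          (tendsto_chartDeriv he m hq.2)
    · set u := Module.finBasis ℝ E' i
      refine ⟨_, ⟨n, v, m + 1, Fin.cons u w, rfl⟩, fun q hq => ?_⟩
      refine (hasLineDerivAt_chartDeriv he m (D n (φ + L q.1) (L ∘ v)) hq.2 w
        u).congr_of_eventuallyEq (Eventually.of_forall fun t => ?_)
      simp only [Module.Basis.prod_apply_inr_fst, Prod.fst_add, Prod.snd_add, Prod.smul_fst,
          Prod.smul_snd, Module.Basis.prod_apply_inr_snd, smul_zero, add_zero]
      rfl
  · refine ⟨0, ![], 0, ![], funext fun q => ?_⟩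
    rw [chartDeriv_zero_apply, hD0]

/-- The `p`-jet of a function on `N` in the chart `e`, at a point of the image of the chart. -/
def chartJet (e : OpenPartialHomeomorph N H) (p : ℕ) (ψ : SmoothFun I N) (y : E) : JetCoeff E p :=
  taylorJet p (ψ ∘ (e.extend I).symm) y

variable [IsManifold I ∞ N] [I.Boundaryless]

theorem chartJet_add {e : OpenPartialHomeomorph N H} (he : e ∈ atlas H N) (p : ℕ)
    (f g : SmoothFun I N) {y : E} (hy : y ∈ (e.extend I).target) :
    chartJet e p (f + g) y = chartJet e p f y + chartJet e p g y :=
  funext fun j => chartDeriv_add he j f g hy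

theorem chartJet_sub {e : OpenPartialHomeomorph N H} (he : e ∈ atlas H N) (p : ℕ)
    (f g : SmoothFun I N) {y : E} (hy : y ∈ (e.extend I).target) :
    chartJet e p (f - g) y = chartJet e p f y - chartJet e p g y :=
  funext fun j => chartDeriv_sub he j f g hy

theorem contDiffOn_chartJet {e : OpenPartialHomeomorph N H} (he : e ∈ atlas H N) (p : ℕ)
    (ψ : SmoothFun I N) : ContDiffOn ℝ ∞ (chartJet e p ψ) (e.extend I).target :=
  contDiffOn_taylorJet e.isOpen_extend_target (contDiffOn_chart he ψ) p

variable [T2Space N] [FiniteDimensional ℝ E]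

/-- A finite-dimensional family of functions realizing all jets at tuples of points near a given
tuple of distinct points, with coefficients depending smoothly on the points. -/
theorem exists_multijet_family (p : ℕ) {k : ℕ} {e : Fin k → OpenPartialHomeomorph N H}
    (he : ∀ i, e i ∈ atlas H N) {y₀ : Fin k → E} (hy₀ : ∀ i, y₀ i ∈ ((e i).extend I).target)
    (hinj : Function.Injective fun i => ((e i).extend I).symm (y₀ i)) :
    ∃ (L : (Fin k → JetCoeff E p) →ₗ[ℝ] SmoothFun I N)
      (τ : (Fin k → E) × (Fin k → JetCoeff E p) → Fin k → JetCoeff E p) (W : Set (Fin k → E)),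
      IsOpen W ∧ y₀ ∈ W ∧ ContDiffOn ℝ ∞ τ (W ×ˢ univ) ∧ (∀ y, τ (y, 0) = 0) ∧
      ∀ y ∈ W, (∀ i, y i ∈ ((e i).extend I).target) ∧ ∀ (ψ : Fin k → SmoothFun I N) (i : Fin k),
        chartJet (e i) p (L (τ (y, fun i => chartJet (e i) p (ψ i) (y i)))) (y i) =
          chartJet (e i) p (ψ i) (y i) := by
  obtain ⟨Q, T, hQ, hT⟩ := exists_jet_family E p
  obtain ⟨U, hU, hdisj⟩ :=
    (finite_range fun i => ((e i).extend I).symm (y₀ i)).t2_separation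
  set x₀ : Fin k → N := fun i => ((e i).extend I).symm (y₀ i) with hx₀
  let O : Fin k → Set E := fun i =>
    ((e i).extend I).target ∩ ((e i).extend I).symm ⁻¹' U (x₀ i)
  have hO : ∀ i, IsOpen (O i) := fun i =>
    (e i).continuousOn_extend_symm.isOpen_inter_preimage (e i).isOpen_extend_target (hU (x₀ i)).2
  have hyO : ∀ i, y₀ i ∈ O i := fun i => ⟨hy₀ i, (hU (x₀ i)).1⟩
  choose η hη hηO hη1 using fun i =>
    exists_chart_bump (I := I) ((hO i).mem_nhds (hyO i)) inter_subset_left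
  let Q' : E → JetCoeff E p →ₗ[ℝ] smoothSubmodule E := fun c =>
    LinearMap.codRestrict (smoothSubmodule E) (LinearMap.funLeft ℝ ℝ (fun z : E => z - c) ∘ₗ Q)
      fun s => (hQ s).comp (contDiff_id.sub contDiff_const)
  -- Each component is centred at `y₀ i` and cut off inside `O i`. These sets lie over disjoint
  -- neighbourhoods of the distinct points, so only the `i`-th summand contributes near the `i`-th
  -- point.
  let L : (Fin k → JetCoeff E p) →ₗ[ℝ] SmoothFun I N :=
    ∑ i, cutoffLift (he i) (hη i) ∘ₗ Q' (y₀ i) ∘ₗ LinearMap.proj i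
  let τ : (Fin k → E) × (Fin k → JetCoeff E p) → Fin k → JetCoeff E p :=
    fun q i => T (q.1 i - y₀ i) (q.2 i)
  obtain ⟨Z, hZT, hZo, hZ0⟩ := eventually_nhds_iff.1 hT
  have hη1' : ∀ i, ∀ᶠ y in 𝓝 (y₀ i), ∀ᶠ z in 𝓝 y, η i z = 1 := fun i =>
    eventually_eventually_nhds.2 (hη1 i)
  choose P hP hPo hP0 using fun i => eventually_nhds_iff.1 (hη1' i)
  -- On `W` each `y i` has a neighbourhood where the cutoff is `1`, so cutting off does not change
  -- the jet at `y i`.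
  let W : Set (Fin k → E) := {y | ∀ i, y i ∈ O i ∧ y i ∈ P i ∧ y i - y₀ i ∈ Z}
  refine ⟨L, τ, W, ?_, ?_, ?_, ?_, ?_⟩
  · have : W = ⋂ i, (fun y : Fin k → E => y i) ⁻¹' (O i ∩ (P i ∩ (fun z => z - y₀ i) ⁻¹' Z)) := by
      ext y
      simp [W]
    rw [this]
    refine isOpen_iInter_of_finite fun i => ?_
    exact ((hO i).inter ((hPo i).inter (hZo.preimage (by fun_prop)))).preimage (continuous_apply i)
  · intro i
    refine ⟨hyO i, hP0 i, ?_⟩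
    rw [sub_self]
    exact hZ0
  · refine contDiffOn_pi.2 fun i => ?_
    rintro ⟨y, a⟩ ⟨hy, -⟩
    refine ContDiffAt.contDiffWithinAt ?_
    have h1 : ContDiffAt ℝ ∞ (fun q : (Fin k → E) × (Fin k → JetCoeff E p) => T (q.1 i - y₀ i))
        (y, a) := by
      refine ContDiffAt.comp (g := T) (f := fun q : (Fin k → E) × (Fin k → JetCoeff E p) =>
        q.1 i - y₀ i) (y, a) (hZT _ (hy i).2.2).1 ?_
      fun_prop
    exact h1.clm_apply (by fun_prop)
  · intro y
    funext i
    exact map_zero (T (y i - y₀ i))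
  · intro y hy
    refine ⟨fun i => (hy i).1.1, fun ψ i => ?_⟩
    set a := fun i => chartJet (e i) p (ψ i) (y i) with ha
    have h1 : L (τ (y, a)) ∘ ((e i).extend I).symm =ᶠ[𝓝 (y i)]
        fun z => Q (T (y i - y₀ i) (a i)) (z - y₀ i) := by
      filter_upwards [(hO i).mem_nhds (hy i).1, hP i (y i) (hy i).2.1] with z hz hzη
      have h2 : L (τ (y, a)) (((e i).extend I).symm z) =
          ∑ j, cutoffLift (he j) (hη j) (Q' (y₀ j) (τ (y, a) j)) (((e i).extend I).symm z) := by
        simp only [L, LinearMap.sum_apply]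
        exact map_sum (evalLinear (((e i).extend I).symm z)) _ Finset.univ
      rw [Function.comp_apply, h2, Finset.sum_eq_single i]
      · have h3 := chartLift_comp_symm (he i) ((hη i).mul
          (ContDiff.contDiffOn (Q' (y₀ i) (τ (y, a) i)).2)) hz.1
        refine h3.trans ?_
        rw [hzη, one_mul]
        rfl
      · intro j _ hji
        refine chartExtend_of_notMem ?_
        rintro ⟨w, hw, hwz⟩
        have hwO := hηO j (tsupport_mul_subset_left hw)
        refine (hdisj (mem_range_self j) (mem_range_self i) (hinj.ne hji)).le_bot ⟨hwO.2, ?_⟩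
        rw [hwz]
        exact hz.2
      · simp
    rw [chartJet, taylorJet_congr h1, taylorJet_comp_sub]
    exact (hZT _ (hy i).2.2).2 _ _ _ ((e i).isOpen_extend_target.mem_nhds (hy i).1.1)
      (contDiffOn_chart (he i) (ψ i))

end Family

/-! ### Local smooth representation by jets. -/

section Local

variable {E : Type*} [NormedAddCommGroup E] [NormedSpace ℝ E] {H : Type*} [TopologicalSpace H]
  {I : ModelWithCorners ℝ E H} {N : Type*} [TopologicalSpace N] [ChartedSpace H N]

variable (I) in
/-- The part of the multi-jet bundle covered by a tuple of charts, in coordinates. -/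
def multiJetDomain {k : ℕ} (e : Fin k → OpenPartialHomeomorph N H) (p : ℕ) :
    Set ((Fin k → E) × (Fin k → JetCoeff E p)) :=
  {q | (∀ i, q.1 i ∈ ((e i).extend I).target) ∧
    Function.Injective fun i => ((e i).extend I).symm (q.1 i)}

-- Being pairwise distinct is an open condition because `N` is Hausdorff: the diagonal is closed.
omit [ChartedSpace H N] in
theorem isOpen_multiJetDomain [I.Boundaryless] [T2Space N] {k : ℕ}
    (e : Fin k → OpenPartialHomeomorph N H) (p : ℕ) : IsOpen (multiJetDomain I e p) := by
  refine isOpen_iff_mem_nhds.2 fun q hq => ?_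
  have h1 : ∀ i, ∀ᶠ q' in 𝓝 q, q'.1 i ∈ ((e i).extend I).target := fun i =>
    ((continuous_apply i).comp continuous_fst).continuousAt.eventually
      ((e i).isOpen_extend_target.mem_nhds (hq.1 i))
  have hc : ∀ i, ContinuousAt (fun q' : (Fin k → E) × (Fin k → JetCoeff E p) =>
      ((e i).extend I).symm (q'.1 i)) q := fun i =>
    ContinuousAt.comp (f := fun q' : (Fin k → E) × (Fin k → JetCoeff E p) => q'.1 i)
      ((e i).continuousAt_extend_symm' (hq.1 i))
      ((continuous_apply i).comp continuous_fst).continuousAt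
  have h2 : ∀ i j, i ≠ j → ∀ᶠ q' in 𝓝 q,
      ((e i).extend I).symm (q'.1 i) ≠ ((e j).extend I).symm (q'.1 j) := fun i j hij =>
    ((hc i).prodMk (hc j)).eventually
      (isClosed_diagonal.isOpen_compl.mem_nhds (hq.2.ne hij))
  filter_upwards [eventually_all.2 h1,
    eventually_all.2 fun i => eventually_all.2 fun j => eventually_all.2 fun hij => h2 i j hij]
    with q' h3 h4
  exact ⟨h3, fun i j hij => by_contra fun hne => h4 i j hne hij⟩

variable [IsManifold I ∞ N] [I.Boundaryless] [T2Space N] [FiniteDimensional ℝ E]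

omit [T2Space N] [FiniteDimensional ℝ E] in
/-- Equicontinuity of the `p`-jets of functions with bounded derivatives up to order `p + 1`. -/
theorem norm_chartJet_sub_le {e : OpenPartialHomeomorph N H} (he : e ∈ atlas H N) {p : ℕ}
    {ψ : SmoothFun I N} {y₀ : E} {r : ℝ} (hr : Metric.ball y₀ r ⊆ (e.extend I).target)
    (hψ : ∀ m ≤ p + 1, ∀ y ∈ Metric.ball y₀ r, ‖chartDeriv e m ψ y‖ ≤ 1) {y : E}
    (hy : y ∈ Metric.ball y₀ r) : ‖chartJet e p ψ y - chartJet e p ψ y₀‖ ≤ ‖y - y₀‖ := by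
  refine (pi_norm_le_iff_of_nonneg (norm_nonneg _)).2 fun j => ?_
  have hr0 : 0 < r := dist_nonneg.trans_lt (Metric.mem_ball.1 hy)
  have h1 := (convex_ball y₀ r).norm_image_sub_le_of_norm_fderiv_le (𝕜 := ℝ)
    (f := chartDeriv e j ψ) (C := 1) (x := y₀) (y := y) (fun z hz =>
      ((contDiffOn_chartDeriv he j ψ).contDiffAt
        (e.isOpen_extend_target.mem_nhds (hr hz))).differentiableAt (by simp))
    (fun z hz => by
      rw [chartDeriv, norm_fderiv_iteratedFDeriv]
      exact hψ (j + 1) (by have := j.2; omega) z hz) (Metric.mem_ball_self hr0) hy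
  rw [one_mul] at h1
  exact h1

/-- Local existence of a smooth function of jets representing a multilocal map. -/
theorem exists_local_jet_function {k : ℕ} {F : SmoothFun I N → SmoothFunPow I N k}
    (hF : IsBastianiSmooth F) {φ : SmoothFun I N} {K : Set (Fin k → N)}
    {T : Set (OpenPartialHomeomorph N H × Set E)} (hT : IsCompactFamily I T) {p : ℕ} {ε : ℝ}
    (hε : 0 < ε) {e : Fin k → OpenPartialHomeomorph N H} (he : ∀ i, e i ∈ atlas H N)
    (hord : ∀ f ∈ jetBall T p ε φ, ∀ g ∈ jetBall T p ε φ, ∀ x ∈ K, Function.Injective x →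
      (∀ i, x i ∈ (e i).source) → (∀ i, jetCoord (e i) p (x i) f = jetCoord (e i) p (x i) g) →
      F f x = F g x)
    {S B : Fin k → Set E} (hS : ∀ i, IsClosed (S i)) (hSB : ∀ i, S i ⊆ interior (B i))
    (hBe : ∀ i, B i ⊆ ((e i).extend I).target)
    {T' : Set (OpenPartialHomeomorph N H × Set E)} (hTT' : T ⊆ T') (hBT' : ∀ i, (e i, B i) ∈ T')
    {ε' : ℝ} (hε' : ε' ≤ ε / 2) (hε'1 : ε' ≤ 1)
    {q₀ : (Fin k → E) × (Fin k → JetCoeff E p)} (hq₀ : q₀ ∈ multiJetDomain I e p) :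
    ∃ U ∈ 𝓝 q₀, ∃ g : (Fin k → E) × (Fin k → JetCoeff E p) → ℝ, ContDiffOn ℝ ∞ g U ∧
      ∀ q ∈ U ∩ multiJetDomain I e p, (∀ i, q.1 i ∈ S i) →
        (fun i => ((e i).extend I).symm (q.1 i)) ∈ K →
        ∀ ψ, φ + ψ ∈ jetBall T' (p + 1) ε' φ → (∀ i, chartJet (e i) p ψ (q.1 i) = q.2 i) →
          g q = F (φ + ψ) fun i => ((e i).extend I).symm (q.1 i) := by
  obtain ⟨y₀, a₀⟩ := q₀
  -- Away from the closed sets `S i` the requirement is empty, and `0` will do.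
  by_cases hy₀S : ∀ i, y₀ i ∈ S i
  swap
  · push Not at hy₀S
    obtain ⟨i, hi⟩ := hy₀S
    refine ⟨{q | q.1 i ∉ S i}, ?_, 0, contDiffOn_const, fun q hq hqS => absurd (hqS i) hq.1⟩
    exact ((hS i).isOpen_compl.preimage (f := fun q : (Fin k → E) × (Fin k → JetCoeff E p) =>
      q.1 i) ((continuous_apply i).comp continuous_fst)).mem_nhds hi
  obtain ⟨L, τ, W, hWo, hy₀W, hτ, hτ0, hW⟩ := exists_multijet_family p he hq₀.1 hq₀.2
  have hsub : ∀ ψ, φ + ψ ∈ jetBall T' (p + 1) ε' φ → ∀ s ∈ T', s.1 ∈ atlas H N →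
      s.2 ⊆ (s.1.extend I).target → ∀ m ≤ p + 1, ∀ y ∈ s.2, ‖chartDeriv s.1 m ψ y‖ < ε' := by
    intro ψ hψ s hs hs1 hs2 m hm y hy
    have h1 := hψ s hs m hm y hy
    rwa [chartDeriv_add hs1 _ _ _ (hs2 hy), add_sub_cancel_left] at h1
  obtain ⟨r, hr, hrB⟩ : ∃ r > 0, ∀ i, Metric.ball (y₀ i) r ⊆ B i := by
    have h1 : ∀ i, ∀ᶠ r in 𝓝[>] (0 : ℝ), Metric.ball (y₀ i) r ⊆ B i := fun i => by
      obtain ⟨r, hr, h⟩ := Metric.mem_nhds_iff.1 (mem_interior_iff_mem_nhds.1 (hSB i (hy₀S i)))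
      filter_upwards [Ioo_mem_nhdsGT hr] with r' hr'
      exact (Metric.ball_subset_ball hr'.2.le).trans h
    obtain ⟨r, hr, hr'⟩ := ((eventually_all.2 h1).and self_mem_nhdsWithin).exists
    exact ⟨r, hr', hr⟩
  -- Since `τ (y₀, 0) = 0`, small jets near `y₀` are realized by small functions. The resulting `δ`
  -- is fixed before `ψ₁` is chosen.
  have hsmall : ∀ᶠ q : (Fin k → E) × (Fin k → JetCoeff E p) in 𝓝 (y₀, 0),
      0 + L (τ q) ∈ jetBall T p (ε / 2) 0 := by
    have h1 : ContinuousAt τ (y₀, 0) :=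
      (hτ.contDiffAt (x := (y₀, 0)) ((hWo.prod isOpen_univ).mem_nhds ⟨hy₀W, mem_univ _⟩)).continuousAt
    have h2 := (continuous_add_linearMap 0 L).continuousAt.comp h1
    refine h2.tendsto.eventually ?_
    simp only [Function.comp_apply, hτ0, map_zero, add_zero]
    exact jetBall_mem_nhds hT p (half_pos hε) 0
  obtain ⟨δ, hδ, hδs⟩ := Metric.eventually_nhds_iff_ball.1 hsmall
  -- If no admissible `ψ` has a jet close to `q₀`, the requirement is vacuous near `q₀`. Otherwise
  -- such a `ψ₁` serves as base function, so that only the difference of jets has to be realized.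
  by_cases hex : ∃ (q : (Fin k → E) × (Fin k → JetCoeff E p)) (ψ : SmoothFun I N),
      ‖q.1 - y₀‖ < min r (δ / 4) ∧ ‖q.2 - a₀‖ < δ / 4 ∧ φ + ψ ∈ jetBall T' (p + 1) ε' φ ∧
      ∀ i, chartJet (e i) p ψ (q.1 i) = q.2 i
  swap
  · refine ⟨{q | ‖q.1 - y₀‖ < min r (δ / 4) ∧ ‖q.2 - a₀‖ < δ / 4}, ?_, 0, contDiffOn_const,
      fun q hq _ _ ψ hψ hψq => absurd ⟨q, ψ, hq.1.1, hq.1.2, hψ, hψq⟩ hex⟩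
    refine IsOpen.mem_nhds (IsOpen.inter ?_ ?_) ⟨by simp [hr, hδ], by simp [hδ]⟩
    · exact isOpen_lt (continuous_fst.sub continuous_const).norm continuous_const
    · exact isOpen_lt (continuous_snd.sub continuous_const).norm continuous_const
  obtain ⟨⟨y₁, a₁⟩, ψ₁, hy₁, ha₁, hψ₁, hψ₁a⟩ := hex
  let J : (Fin k → E) → Fin k → JetCoeff E p := fun y i => chartJet (e i) p ψ₁ (y i)
  have hJ : ContDiffOn ℝ ∞ J {y | ∀ i, y i ∈ ((e i).extend I).target} :=
    contDiffOn_pi.2 fun i => (contDiffOn_chartJet (he i) p ψ₁).comp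
      (contDiff_apply ℝ E i).contDiffOn fun y hy => hy i
  -- The jet of `ψ₁` is near `q₀` only at `y₁`. The bound on its derivatives up to order `p + 1`
  -- makes `J` vary by at most the displacement, which transports the estimate to `y₀`.
  have hJ₀ : ‖a₀ - J y₀‖ < δ := by
    have h1 : ‖J y₁ - J y₀‖ < δ / 4 := by
      refine ((pi_norm_le_iff_of_nonneg (norm_nonneg _)).2 fun i => ?_).trans_lt
        (hy₁.trans_le (min_le_right _ _))
      have h2 : y₁ i ∈ Metric.ball (y₀ i) r := by
        rw [mem_ball_iff_norm]
        exact (norm_le_pi_norm (y₁ - y₀) i).trans_lt (hy₁.trans_le (min_le_left _ _))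
      refine (norm_chartJet_sub_le (he i) ((hrB i).trans (hBe i)) (fun m hm y hy => ?_) h2).trans
        (norm_le_pi_norm (y₁ - y₀) i)
      exact ((hsub ψ₁ hψ₁ _ (hBT' i) (he i) (hBe i) m hm y (hrB i hy)).trans_le hε'1).le
    have h3 : J y₁ = a₁ := funext hψ₁a
    rw [h3] at h1
    calc ‖a₀ - J y₀‖ = ‖(a₁ - J y₀) - (a₁ - a₀)‖ := by congr 1; abel
      _ ≤ ‖a₁ - J y₀‖ + ‖a₁ - a₀‖ := norm_sub_le _ _
      _ < δ / 4 + δ / 4 := add_lt_add h1 ha₁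
      _ < δ := by linarith
  have hWt : W ⊆ {y | ∀ i, y i ∈ ((e i).extend I).target} := fun y hy => (hW y hy).1
  have hc : ContDiffOn ℝ ∞ (fun q : (Fin k → E) × (Fin k → JetCoeff E p) => (q.1, q.2 - J q.1))
      (W ×ˢ univ) :=
    contDiff_fst.contDiffOn.prodMk (contDiff_snd.contDiffOn.sub
      ((hJ.mono hWt).comp contDiff_fst.contDiffOn fun q hq => hq.1))
  let U : Set ((Fin k → E) × (Fin k → JetCoeff E p)) :=
    (W ×ˢ univ) ∩ (fun q => (q.1, q.2 - J q.1)) ⁻¹' Metric.ball (y₀, 0) δ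
  have hUo : IsOpen U :=
    hc.continuousOn.isOpen_inter_preimage (hWo.prod isOpen_univ) Metric.isOpen_ball
  have hU₀ : (y₀, a₀) ∈ U := by
    refine ⟨⟨hy₀W, mem_univ _⟩, ?_⟩
    rw [mem_preimage, mem_ball_iff_norm, Prod.norm_def]
    simpa [hδ] using hJ₀
  refine ⟨U, hUo.mem_nhds hU₀, fun q => F (φ + ψ₁ + L (τ (q.1, q.2 - J q.1)))
    fun i => ((e i).extend I).symm (q.1 i), ?_, ?_⟩
  · have h1 := hF.contDiffOn_family (φ + ψ₁) L (e := OpenPartialHomeomorph.pi e)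
      (mem_image_of_mem _ fun i _ => he i)
    refine h1.comp (f := fun q : (Fin k → E) × (Fin k → JetCoeff E p) =>
      (τ (q.1, q.2 - J q.1), q.1)) ?_ ?_
    · refine ContDiffOn.prodMk ?_ contDiff_fst.contDiffOn
      exact hτ.comp (hc.mono inter_subset_left) fun q hq => ⟨hq.1.1, mem_univ _⟩
    · exact fun q hq => ⟨mem_univ _, (mem_extend_pi_target e q.1).2 (hWt hq.1.1)⟩
  · rintro ⟨y, a⟩ ⟨hq, hqd⟩ - hyK ψ hψ hψa
    have hy : ∀ i, y i ∈ ((e i).extend I).target := hqd.1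
    have hs : ∀ i, ((e i).extend I).symm (y i) ∈ (e i).source := fun i => by
      rw [← (e i).extend_source (I := I)]
      exact ((e i).extend I).map_target (hy i)
    have hLs := hδs _ hq.2
    rw [zero_add] at hLs
    -- It remains to compare `φ + ψ₁ + L (τ …)` with `φ + ψ`: both lie in the ball where the order
    -- is `p` (the first as `ε / 2 + ε / 2`), and their `p`-jets at the points agree.
    refine hord _ ?_ _ ?_ _ hyK hqd.2 hs fun i => ?_
    · intro s hs m hm z hz
      have hse := (hT.2 s hs).1
      have hz' := (hT.2 s hs).2.2 hz
      have h1 := hsub ψ₁ hψ₁ s (hTT' hs) hse (hT.2 s hs).2.2 m (by omega) z hz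
      have h2 := hLs s hs m hm z hz
      rw [← chartDeriv_sub hse _ _ _ hz', sub_zero] at h2
      rw [add_assoc, chartDeriv_add hse _ _ _ hz', add_sub_cancel_left,
        chartDeriv_add hse _ _ _ hz']
      calc _ ≤ _ + _ := norm_add_le _ _
        _ < ε / 2 + ε / 2 := add_lt_add (h1.trans_le hε') h2
        _ = ε := add_halves ε
    · intro s hs m hm z hz
      refine (hψ s (hTT' hs) m (by omega) z hz).trans_le ?_
      linarith
    · change chartJet (e i) p _ ((e i).extend I (((e i).extend I).symm (y i))) =
        chartJet (e i) p _ ((e i).extend I (((e i).extend I).symm (y i)))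
      rw [((e i).extend I).right_inv (hy i), add_assoc, chartJet_add (he i) p _ _ (hy i),
        chartJet_add (he i) p _ _ (hy i), chartJet_add (he i) p _ _ (hy i), hψa i]
      have h1 := (hW y hq.1.1).2 (fun _ => ψ - ψ₁) i
      have h2 : (fun i => chartJet (e i) p (ψ - ψ₁) (y i)) = a - J y := funext fun i => by
        rw [chartJet_sub (he i) p _ _ (hy i), hψa i]
        rfl
      rw [h2] at h1
      rw [h1, chartJet_sub (he i) p _ _ (hy i), hψa i, add_sub_cancel]

end Local

/-! ### Gluing over the jet bundle. -/

section Global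

variable {E : Type*} [NormedAddCommGroup E] [NormedSpace ℝ E] {H : Type*} [TopologicalSpace H]
  {I : ModelWithCorners ℝ E H} {N : Type*} [TopologicalSpace N] [ChartedSpace H N]
  [IsManifold I ∞ N] [I.Boundaryless]

theorem jetCoord_transition {e e' : OpenPartialHomeomorph N H} (he : e ∈ atlas H N)
    (he' : e' ∈ atlas H N) (p : ℕ) {x : N} (hx : x ∈ e.source) (hx' : x ∈ e'.source)
    (ψ : SmoothFun I N) :
    jetCoord e p x ψ = jetTransition p (e'.extend I ∘ (e.extend I).symm) (e.extend I x)
      (jetCoord e' p x ψ) := by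
  have hz : e.extend I x ∈ (e.extend I).target ∩ (e.extend I).symm ⁻¹' e'.source := by
    refine ⟨(e.extend I).map_source (by rwa [e.extend_source]), ?_⟩
    rwa [mem_preimage, e.extend_left_inv hx]
  have hσx : (e'.extend I ∘ (e.extend I).symm) (e.extend I x) = e'.extend I x := by
    rw [Function.comp_apply, e.extend_left_inv hx]
  have h1 : ψ ∘ (e.extend I).symm =ᶠ[𝓝 (e.extend I x)]
      (ψ ∘ (e'.extend I).symm) ∘ (e'.extend I ∘ (e.extend I).symm) := by
    filter_upwards [(isOpen_chart_overlap e e').mem_nhds hz] with w hw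
    simp only [Function.comp_apply]
    rw [e'.extend_left_inv hw.2]
  have h2 : ContDiffAt ℝ ∞ (ψ ∘ (e'.extend I).symm)
      ((e'.extend I ∘ (e.extend I).symm) (e.extend I x)) := by
    rw [hσx]
    exact contDiffAt_chart he' ψ ((e'.extend I).map_source (by rwa [e'.extend_source]))
  change taylorJet p (ψ ∘ (e.extend I).symm) (e.extend I x) = _
  rw [taylorJet_congr h1, taylorJet_comp h2 ((contDiffOn_chart_transition he he').contDiffAt
    ((isOpen_chart_overlap e e').mem_nhds hz)), hσx]
  rfl

omit [ChartedSpace H N] [IsManifold I ∞ N] [I.Boundaryless] in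
theorem mem_overlap_symm {e e' : OpenPartialHomeomorph N H} {y : E}
    (hy : y ∈ (e'.extend I).target) (hye : (e'.extend I).symm y ∈ e.source) :
    e.extend I ((e'.extend I).symm y) ∈ (e.extend I).target ∩ (e.extend I).symm ⁻¹' e'.source := by
  refine ⟨(e.extend I).map_source (by rwa [e.extend_source]), ?_⟩
  rw [mem_preimage, e.extend_left_inv hye, ← e'.extend_source (I := I)]
  exact (e'.extend I).map_target hy

variable [FiniteDimensional ℝ E]

/-- A smooth function of multi-jets in given charts, multiplied by functions supported in these
charts, is smooth in all charts. -/
theorem contDiffOn_multiJet_transition [T2Space N] {k p : ℕ}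
    {e e' : Fin k → OpenPartialHomeomorph N H}
    (he : ∀ i, e i ∈ atlas H N) (he' : ∀ i, e' i ∈ atlas H N) {C : Fin k → Set N}
    (hC : ∀ i, IsClosed (C i)) (hCe : ∀ i, C i ⊆ (e i).source) {θ : Fin k → SmoothFun I N}
    (hθ : ∀ i, ∀ x ∉ C i, θ i x = 0) {g : (Fin k → E) × (Fin k → JetCoeff E p) → ℝ}
    (hg : ContDiffOn ℝ ∞ g (multiJetDomain I e p)) :
    ContDiffOn ℝ ∞ (fun q : (Fin k → E) × (Fin k → JetCoeff E p) =>
      (∏ i, θ i (((e' i).extend I).symm (q.1 i))) *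
        g (fun i => (e i).extend I (((e' i).extend I).symm (q.1 i)),
          fun i => jetTransition p ((e' i).extend I ∘ ((e i).extend I).symm)
            ((e i).extend I (((e' i).extend I).symm (q.1 i))) (q.2 i)))
      (multiJetDomain I e' p) := by
  intro q hq
  refine ContDiffAt.contDiffWithinAt ?_
  have hπ : ∀ i, ContDiffAt ℝ ∞ (fun q : (Fin k → E) × (Fin k → JetCoeff E p) => q.1 i) q :=
    fun i => by fun_prop
  by_cases hs : ∀ i, ((e' i).extend I).symm (q.1 i) ∈ (e i).source
  · have hθs : ∀ i, ContDiffAt ℝ ∞ (fun q : (Fin k → E) × (Fin k → JetCoeff E p) =>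
        θ i (((e' i).extend I).symm (q.1 i))) q := fun i =>
      ContDiffAt.comp (g := θ i ∘ ((e' i).extend I).symm) q
        (contDiffAt_chart (he' i) (θ i) (hq.1 i)) (hπ i)
    have hσ : ∀ i, ContDiffAt ℝ ∞ (fun q : (Fin k → E) × (Fin k → JetCoeff E p) =>
        (e i).extend I (((e' i).extend I).symm (q.1 i))) q := fun i =>
      ContDiffAt.comp (g := (e i).extend I ∘ ((e' i).extend I).symm) q
        ((contDiffOn_chart_transition (he' i) (he i)).contDiffAt
          ((isOpen_chart_overlap (e' i) (e i)).mem_nhds ⟨hq.1 i, hs i⟩)) (hπ i)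
    have hov := fun i => mem_overlap_symm (hq.1 i) (hs i)
    have hj : ∀ i, ContDiffAt ℝ ∞ (fun q : (Fin k → E) × (Fin k → JetCoeff E p) =>
        jetTransition p ((e' i).extend I ∘ ((e i).extend I).symm)
            ((e i).extend I (((e' i).extend I).symm (q.1 i))) (q.2 i)) q := fun i =>
      ContDiffAt.comp (g := fun r : E × JetCoeff E p =>
        jetTransition p ((e' i).extend I ∘ ((e i).extend I).symm) r.1 r.2)
        (f := fun q : (Fin k → E) × (Fin k → JetCoeff E p) =>
          ((e i).extend I (((e' i).extend I).symm (q.1 i)), q.2 i)) q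
        ((contDiffOn_jetTransition p (isOpen_chart_overlap (e i) (e' i))
          (contDiffOn_chart_transition (he i) (he' i))).contDiffAt
          (((isOpen_chart_overlap (e i) (e' i)).prod isOpen_univ).mem_nhds ⟨hov i, mem_univ _⟩))
        ((hσ i).prodMk (by fun_prop))
    refine (contDiffAt_prod fun i _ => hθs i).mul ?_
    refine ContDiffAt.comp (g := g) (f := fun q : (Fin k → E) × (Fin k → JetCoeff E p) =>
      (fun i => (e i).extend I (((e' i).extend I).symm (q.1 i)),
          fun i => jetTransition p ((e' i).extend I ∘ ((e i).extend I).symm)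
            ((e i).extend I (((e' i).extend I).symm (q.1 i))) (q.2 i))) q ?_
      ((contDiffAt_pi.2 hσ).prodMk (contDiffAt_pi.2 hj))
    refine hg.contDiffAt ((isOpen_multiJetDomain e p).mem_nhds ⟨fun i => (hov i).1, ?_⟩)
    have h1 : (fun i => ((e i).extend I).symm ((e i).extend I (((e' i).extend I).symm (q.1 i)))) =
        fun i => ((e' i).extend I).symm (q.1 i) :=
      funext fun i => (e i).extend_left_inv (hs i)
    simp only [h1]
    exact hq.2
  -- Some point lies outside the chart, hence off the closed set `C i`; the factor `θ i` vanishes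
  -- near it, whatever `g` does there.
  · push Not at hs
    obtain ⟨i, hi⟩ := hs
    have hc : ContinuousAt (fun q : (Fin k → E) × (Fin k → JetCoeff E p) =>
        ((e' i).extend I).symm (q.1 i)) q :=
      ContinuousAt.comp (f := fun q : (Fin k → E) × (Fin k → JetCoeff E p) => q.1 i)
        ((e' i).continuousAt_extend_symm' (hq.1 i)) (hπ i).continuousAt
    refine (contDiffAt_const (c := (0 : ℝ))).congr_of_eventuallyEq ?_
    filter_upwards [hc.eventually ((hC i).isOpen_compl.mem_nhds fun h => hi (hCe i h))] with r hr
    rw [Finset.prod_eq_zero (Finset.mem_univ i) (hθ i _ hr), zero_mul]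

variable [T2Space N]

/-- A finite smooth partition of unity on a compact set, subordinate to charts. -/
theorem exists_finite_chart_partition {L : Set N} (hL : IsCompact L) :
    ∃ (n : ℕ) (e : Fin n → OpenPartialHomeomorph N H) (η : Fin n → E → ℝ)
      (θ : Fin n → SmoothFun I N), (∀ j, e j ∈ atlas H N) ∧ (∀ j, IsChartCutoff I (e j) (η j)) ∧
      (∀ j, ∀ x ∉ ((e j).extend I).symm '' tsupport (η j), θ j x = 0) ∧
      ∀ x ∈ L, ∑ j, θ j x = 1 := by
  have hx : ∀ x : N, (chartAt H x).extend I x ∈ ((chartAt H x).extend I).target := fun x =>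
    ((chartAt H x).extend I).map_source (by simp)
  choose η hη _ hη1 using fun x : N => exists_chart_bump (I := I)
    ((chartAt H x).isOpen_extend_target.mem_nhds (hx x)) Subset.rfl
  have hnhds : ∀ x : N, ∀ᶠ z in 𝓝 x, chartLift (chart_mem_atlas H x) (hη x) z = 1 := fun x => by
    filter_upwards [((chartAt H x).continuousAt_extend (mem_chart_source H x)).eventually (hη1 x),
      (chartAt H x).open_source.mem_nhds (mem_chart_source H x)] with z hz hzs
    exact (chartExtend_of_mem hzs _).trans hz
  obtain ⟨t, -, ht⟩ := hL.elim_nhds_subcover _ fun x _ => hnhds x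
  let c : Fin t.card → N := fun j => (t.equivFin.symm j : N)
  let f : Fin t.card → SmoothFun I N := fun j => chartLift (chart_mem_atlas H (c j)) (hη (c j))
  refine ⟨t.card, fun j => chartAt H (c j), fun j => η (c j),
    -- The sum telescopes to `1 - ∏ (1 - f j)`, and on `L` some `f j` equals `1`.
    fun j => f j * ∏ i with i < j, (1 - f i), fun j => chart_mem_atlas H _, fun j => hη _,
    fun j x hxj => ?_, fun x hxL => ?_⟩
  · have h0 : f j x = 0 := chartExtend_of_notMem hxj
    change f j x * (∏ i with i < j, (1 - f i)) x = 0
    rw [h0, zero_mul]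
  · have h1 : ∀ j, (f j * ∏ i with i < j, (1 - f i) : SmoothFun I N) x =
        f j x * ∏ i with i < j, (1 - f i x) := by
      intro j
      change f j x * (∏ i with i < j, (1 - f i)) x = _
      congr 1
      exact map_prod (ContMDiffMap.evalRingHom x : SmoothFun I N →+* ℝ) _ _
    simp only [h1]
    have h2 := Finset.prod_one_sub_ordered Finset.univ fun j => f j x
    have h3 : ∏ j, (1 - f j x) = 0 := by
      obtain ⟨z, hz, hzx⟩ := mem_iUnion₂.1 (ht hxL)
      refine Finset.prod_eq_zero (Finset.mem_univ (t.equivFin ⟨z, hz⟩)) ?_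
      have h4 : c (t.equivFin ⟨z, hz⟩) = z := by simp [c]
      have h5 : f (t.equivFin ⟨z, hz⟩) x = 1 := by
        simp only [f]
        rw [h4]
        exact hzx
      rw [h5, sub_self]
    rw [h3] at h2
    linarith

/-- The second Peetre theorem. -/
theorem exists_multiJet_function {k : ℕ} {F : SmoothFun I N → SmoothFunPow I N k}
    (hF : IsBastianiSmooth F) (hloc : IsMultilocal F) (φ : SmoothFun I N) {K : Set (Fin k → N)}
    (hK : IsCompact K) :
    ∃ V ∈ 𝓝 φ, ∃ (p : ℕ) (c : MultiJetBundle I N p k → ℝ), IsSmoothOnMultiJets c ∧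
      ∀ ψ : SmoothFun I N, φ + ψ ∈ V → ∀ x : ConfigSpace N k, x.1 ∈ K →
        F (φ + ψ) x.1 = c ⟨x, fun i => jet p (x.1 i) ψ⟩ := by
  obtain ⟨T, p, ε, hT, hε, hord⟩ := exists_order hF hloc φ hK
  have hL : IsCompact (⋃ i, (fun x : Fin k → N => x i) '' K) :=
    isCompact_iUnion fun i => hK.image (continuous_apply i)
  obtain ⟨n, e, η, θ, he, hη, hθ, hθ1⟩ := exists_finite_chart_partition (I := I) hL
  -- The compact sets `B j` are larger than the supports, so derivatives are controlled on a ball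
  -- around each point of a support.
  choose B hB hηB hBe using fun j => exists_compact_between (hη j).isCompact_tsupport
    (e j).isOpen_extend_target (hη j).tsupport_subset
  let T' : Set (OpenPartialHomeomorph N H × Set E) := T ∪ range fun j => (e j, B j)
  have hT' : IsCompactFamily I T' := by
    refine ⟨hT.1.union (finite_range _), ?_⟩
    rintro q (hq | ⟨j, rfl⟩)
    exacts [hT.2 q hq, ⟨he j, hB j, hBe j⟩]
  -- Half of `ε` is left for the correction added to `ψ₁`; the bound `1` gives the Lipschitz
  -- constant for jets.
  set ε' : ℝ := min (ε / 2) 1 with hε'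
  have hε'0 : 0 < ε' := lt_min (half_pos hε) one_pos
  -- The prescribed set of values is all of `ℝ` where no admissible `ψ` has the given jet and at
  -- most one point elsewhere, hence convex; the local lemma supplies smooth local selections.
  have hJ : ∀ J : Fin k → Fin n, ∃ g : (Fin k → E) × (Fin k → JetCoeff E p) → ℝ,
      ContDiffOn ℝ ∞ g (multiJetDomain I (fun i => e (J i)) p) ∧
      ∀ q ∈ multiJetDomain I (fun i => e (J i)) p, g q ∈ {r : ℝ |
        (∀ i, q.1 i ∈ tsupport (η (J i))) → (fun i => ((e (J i)).extend I).symm (q.1 i)) ∈ K →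
        ∀ ψ, φ + ψ ∈ jetBall T' (p + 1) ε' φ → (∀ i, chartJet (e (J i)) p ψ (q.1 i) = q.2 i) →
          r = F (φ + ψ) fun i => ((e (J i)).extend I).symm (q.1 i)} := by
    intro J
    refine exists_contDiffOn_forall_mem_convex (isOpen_multiJetDomain _ p) _ ?_ ?_
    · intro q _ r hr s hs a b _ _ hab hqS hqK ψ hψ hψq
      rw [hr hqS hqK ψ hψ hψq, hs hqS hqK ψ hψ hψq, ← add_smul, hab, one_smul]
    · intro q hq
      exact exists_local_jet_function (T' := T') hF hT hε (fun i => he (J i))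
        (fun f hf g hg x hx hinj hxe hfg => hord f hf g hg x hx hinj _ (fun i => he (J i)) hxe hfg)
        (fun i => isClosed_tsupport (η (J i))) (fun i => hηB (J i)) (fun i => hBe (J i))
        subset_union_left (fun i => Or.inr ⟨J i, rfl⟩) (min_le_left _ _) (min_le_right _ _) hq
  choose g hg hgF using hJ
  let rep : ∀ x : N, JetSpace I p x → SmoothFun I N := fun x =>
    Function.surjInv Ideal.Quotient.mk_surjective
  have hrep : ∀ (x : N) (ψ : SmoothFun I N), jet p x (rep x (jet p x ψ)) = jet p x ψ :=
    fun x ψ => Function.surjInv_eq Ideal.Quotient.mk_surjective _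
  have hθs : ∀ j x, θ j x ≠ 0 → x ∈ (e j).source := by
    intro j x hx
    by_contra hxe
    refine hx (hθ j x ?_)
    rintro ⟨y, hy, rfl⟩
    refine hxe ?_
    rw [← (e j).extend_source (I := I)]
    exact ((e j).extend I).map_target ((hη j).tsupport_subset hy)
  -- One term for each assignment of charts to the `k` points. Where a chart misses its point the
  -- weight is `0`, so the unspecified values of `g` and the choice of representative are harmless.
  let c : MultiJetBundle I N p k → ℝ := fun a => ∑ J : Fin k → Fin n,
    (∏ i, θ (J i) (a.1.1 i)) * g J (fun i => (e (J i)).extend I (a.1.1 i),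
      fun i => jetCoord (e (J i)) p (a.1.1 i) (rep _ (a.2 i)))
  have hc : ∀ (x : ConfigSpace N k) (ψ : Fin k → SmoothFun I N),
      c ⟨x, fun i => jet p (x.1 i) (ψ i)⟩ = ∑ J : Fin k → Fin n,
        (∏ i, θ (J i) (x.1 i)) * g J (fun i => (e (J i)).extend I (x.1 i),
          fun i => jetCoord (e (J i)) p (x.1 i) (ψ i)) := by
    intro x ψ
    refine Finset.sum_congr rfl fun J _ => ?_
    by_cases hs : ∀ i, x.1 i ∈ (e (J i)).source
    · have h1 : (fun i => jetCoord (e (J i)) p (x.1 i) (rep _ (jet p (x.1 i) (ψ i)))) =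
          fun i => jetCoord (e (J i)) p (x.1 i) (ψ i) :=
        funext fun i => jetCoord_eq_of_jet_eq (he (J i)) (hs i) (hrep _ _)
      simp only [h1]
    · push Not at hs
      obtain ⟨i, hi⟩ := hs
      have h0 : θ (J i) (x.1 i) = 0 := by_contra fun h => hi (hθs _ _ h)
      rw [Finset.prod_eq_zero (Finset.mem_univ i) h0, zero_mul, zero_mul]
  refine ⟨jetBall T' (p + 1) ε' φ, jetBall_mem_nhds hT' _ hε'0 φ, p, c, ?_, ?_⟩
  · intro e' he'
    refine ⟨fun q => ∑ J : Fin k → Fin n,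
      (∏ i, θ (J i) (((e' i).extend I).symm (q.1 i))) *
        g J (fun i => (e (J i)).extend I (((e' i).extend I).symm (q.1 i)),
          fun i => jetTransition p ((e' i).extend I ∘ ((e (J i)).extend I).symm)
            ((e (J i)).extend I (((e' i).extend I).symm (q.1 i))) (q.2 i)), ?_, ?_⟩
    · refine ContDiffOn.sum fun J _ => ?_
      refine contDiffOn_multiJet_transition (fun i => he (J i)) he'
        (C := fun i => ((e (J i)).extend I).symm '' tsupport (η (J i)))
        (fun i => (hη (J i)).isClosed_image) (fun i => ?_) (fun i => hθ (J i)) (hg J)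
      rintro _ ⟨y, hy, rfl⟩
      rw [← (e (J i)).extend_source (I := I)]
      exact ((e (J i)).extend I).map_target ((hη (J i)).tsupport_subset hy)
    · intro x hx ψ
      rw [hc]
      refine Finset.sum_congr rfl fun J _ => ?_
      have hx' : ∀ i, ((e' i).extend I).symm ((e' i).extend I (x.1 i)) = x.1 i := fun i =>
        (e' i).extend_left_inv (hx i)
      simp only [hx']
      by_cases hs : ∀ i, x.1 i ∈ (e (J i)).source
      · congr 3
        funext i
        exact jetCoord_transition (he (J i)) (he' i) p (hs i) (hx i) (ψ i)
      · push Not at hs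
        obtain ⟨i, hi⟩ := hs
        have h0 : θ (J i) (x.1 i) = 0 := by_contra fun h => hi (hθs _ _ h)
        rw [Finset.prod_eq_zero (Finset.mem_univ i) h0, zero_mul, zero_mul]
  · intro ψ hψ x hxK
    rw [hc x fun _ => ψ]
    have h1 : ∀ J : Fin k → Fin n, (∏ i, θ (J i) (x.1 i)) *
        g J (fun i => (e (J i)).extend I (x.1 i), fun i => jetCoord (e (J i)) p (x.1 i) ψ) =
        (∏ i, θ (J i) (x.1 i)) * F (φ + ψ) x.1 := by
      intro J
      by_cases h0 : ∏ i, θ (J i) (x.1 i) = 0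
      · rw [h0, zero_mul, zero_mul]
      have hne : ∀ i, θ (J i) (x.1 i) ≠ 0 := fun i hi =>
        h0 (Finset.prod_eq_zero (Finset.mem_univ i) hi)
      have hs := fun i => hθs _ _ (hne i)
      have hx' : (fun i => ((e (J i)).extend I).symm ((e (J i)).extend I (x.1 i))) = x.1 :=
        funext fun i => (e (J i)).extend_left_inv (hs i)
      congr 1
      have h2 := hgF J (fun i => (e (J i)).extend I (x.1 i),
        fun i => jetCoord (e (J i)) p (x.1 i) ψ) ⟨fun i =>
          ((e (J i)).extend I).map_source (by rw [(e (J i)).extend_source]; exact hs i), by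
          simp only [hx']; exact x.2⟩
      simp only [hx'] at h2
      refine h2 (fun i => ?_) hxK ψ hψ fun i => rfl
      have h3 : x.1 i ∈ ((e (J i)).extend I).symm '' tsupport (η (J i)) :=
        by_contra fun h => hne i (hθ _ _ h)
      obtain ⟨y, hy, hyx⟩ := h3
      simp only [← hyx]
      rwa [((e (J i)).extend I).right_inv ((hη (J i)).tsupport_subset hy)]
    rw [Finset.sum_congr rfl fun J _ => h1 J, ← Finset.sum_mul]
    -- The sum over all assignments factors as `∏ i, ∑ j, θ j (x i)`, and each factor is `1` because
    -- `x i` lies in a projection of `K`.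
    have h2 : ∑ J : Fin k → Fin n, ∏ i, θ (J i) (x.1 i) = 1 := by
      have h3 := Finset.prod_univ_sum (fun _ : Fin k => (Finset.univ : Finset (Fin n)))
        fun i j => θ j (x.1 i)
      rw [Fintype.piFinset_univ] at h3
      rw [← h3]
      exact Finset.prod_eq_one fun i _ =>
        hθ1 _ (mem_iUnion.2 ⟨i, mem_image_of_mem (fun x : Fin k → N => x i) hxK⟩)
    rw [h2, one_mul]

end Global

/-! ### The one-point case, by identifying `N` with `N¹`. -/

section OnePoint

variable {E : Type*} [NormedAddCommGroup E] [NormedSpace ℝ E] {H : Type*} [TopologicalSpace H]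
  {I : ModelWithCorners ℝ E H} {N : Type*} [TopologicalSpace N] [ChartedSpace H N]
  [IsManifold I ∞ N] [I.Boundaryless]

theorem contMDiff_comp_apply_zero (g : SmoothFun I N) :
    ContMDiff (ModelWithCorners.pi fun _ : Fin 1 => I) 𝓘(ℝ, ℝ) ∞
      fun x : Fin 1 → N => g (x 0) := by
  intro x
  let e : Fin 1 → OpenPartialHomeomorph N H := fun i => chartAt H (x i)
  let e' : OpenPartialHomeomorph (Fin 1 → N) (ModelPi fun _ : Fin 1 => H) :=
    OpenPartialHomeomorph.pi e
  have he' : e' ∈ atlas (ModelPi fun _ : Fin 1 => H) (Fin 1 → N) :=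
    mem_image_of_mem _ fun i _ => chart_mem_atlas H (x i)
  have hx : x ∈ e'.source := fun i _ => mem_chart_source H (x i)
  have hx0 : (e 0).extend I (x 0) ∈ ((e 0).extend I).target :=
    ((e 0).extend I).map_source (by simp [e])
  have h1 : ContMDiffAt (ModelWithCorners.pi fun _ : Fin 1 => I) 𝓘(ℝ, Fin 1 → E) ∞
      (e'.extend (ModelWithCorners.pi fun _ : Fin 1 => I)) x :=
    (e'.contMDiffOn_extend (IsManifold.subset_maximalAtlas he')).contMDiffAt
      (e'.open_source.mem_nhds hx)
  have h2 : ContDiffAt ℝ ∞ (fun y : Fin 1 → E => g (((e 0).extend I).symm (y 0)))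
      (e'.extend (ModelWithCorners.pi fun _ : Fin 1 => I) x) :=
    ContDiffAt.comp (g := g ∘ ((e 0).extend I).symm) (f := fun y : Fin 1 → E => y 0) _
      (contDiffAt_chart (chart_mem_atlas H (x 0)) g hx0) (by fun_prop)
  refine (h2.contMDiffAt.comp x h1).congr_of_eventuallyEq ?_
  filter_upwards [e'.open_source.mem_nhds hx] with z hz
  change g (z 0) = g (((e 0).extend I).symm ((e 0).extend I (z 0)))
  rw [(e 0).extend_left_inv (hz 0 (mem_univ _))]

/-- A function on `N`, regarded as a function on `N¹`. -/
def toPowOne (g : SmoothFun I N) : SmoothFunPow I N 1 :=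
  ⟨fun x => g (x 0), contMDiff_comp_apply_zero g⟩

/-- In charts the map is precomposition with a linear projection of norm at most `1`, which does not
increase the norms of derivatives. -/
theorem continuous_toPowOne : Continuous (toPowOne : SmoothFun I N → SmoothFunPow I N 1) := by
  refine continuous_iff_continuousAt.2 fun φ => tendsto_smoothFun_iff.2 ?_
  rintro _ ⟨e, he, rfl⟩ m K hK hKe ε hε
  have he0 : e 0 ∈ atlas H N := he 0 (mem_univ _)
  have hO := (e 0).isOpen_extend_target (I := I)
  let P : (Fin 1 → E) →L[ℝ] E := ContinuousLinearMap.proj 0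
  have hP : ‖P‖ ≤ 1 := ContinuousLinearMap.opNorm_le_bound _ zero_le_one fun y => by
    rw [one_mul]
    exact norm_le_pi_norm y 0
  have hK0 : (fun y : Fin 1 → E => y 0) '' K ⊆ ((e 0).extend I).target := by
    rintro _ ⟨y, hy, rfl⟩
    exact (mem_extend_pi_target e y).1 (hKe hy) 0
  let e' : OpenPartialHomeomorph (Fin 1 → N) (ModelPi fun _ : Fin 1 => H) :=
    OpenPartialHomeomorph.pi e
  have hD : ∀ g : SmoothFun I N, ∀ y ∈ K, chartDeriv e' m (toPowOne g) y =
      (chartDeriv (e 0) m g (y 0)).compContinuousLinearMap fun _ => P := by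
    intro g y hy
    have hy0 : P y ∈ ((e 0).extend I).target := hK0 (mem_image_of_mem _ hy)
    have hO' : IsOpen (P ⁻¹' ((e 0).extend I).target) := hO.preimage P.continuous
    have h1 := P.iteratedFDerivWithin_comp_right (contDiffOn_chart he0 g) hO.uniqueDiffOn
      hO'.uniqueDiffOn hy0 (i := m) (by exact_mod_cast le_top)
    rw [iteratedFDerivWithin_of_isOpen m hO hy0, iteratedFDerivWithin_of_isOpen m hO' hy0] at h1
    exact h1
  filter_upwards [tendsto_smoothFun_iff.1 (tendsto_id (x := 𝓝 φ)) (e 0) he0 m _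
    (hK.image (continuous_apply 0)) hK0 ε hε] with g hg y hy
  have h1 := hg (y 0) (mem_image_of_mem _ hy)
  change ‖chartDeriv e' m (toPowOne g) y - chartDeriv e' m (toPowOne φ) y‖ < ε
  rw [hD g y hy, hD φ y hy]
  have h2 : ((chartDeriv (e 0) m g (y 0)).compContinuousLinearMap fun _ => P) -
      ((chartDeriv (e 0) m φ (y 0)).compContinuousLinearMap fun _ => P) =
      (chartDeriv (e 0) m g (y 0) - chartDeriv (e 0) m φ (y 0)).compContinuousLinearMap
        fun _ => P := rfl
  rw [h2]
  refine (ContinuousMultilinearMap.norm_compContinuousLinearMap_le _ _).trans_lt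
    (lt_of_le_of_lt ?_ h1)
  refine mul_le_of_le_one_right (norm_nonneg _) ?_
  exact Finset.prod_le_one (fun _ _ => norm_nonneg _) fun _ _ => hP

/-- `toPowOne` is linear and continuous, so it commutes with difference quotients and their limits.
-/
theorem IsBastianiSmooth.toPowOne_comp {F : SmoothFun I N → SmoothFun I N}
    (hF : IsBastianiSmooth F) : IsBastianiSmooth fun φ => toPowOne (F φ) := by
  obtain ⟨D, hD0, hD, hDc⟩ := hF
  refine ⟨fun n x v => toPowOne (D n x v), fun x v => congrArg toPowOne (hD0 x v), fun n x v w => ?_,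
    fun n => continuous_toPowOne.comp (hDc n)⟩
  exact (continuous_toPowOne.tendsto _).comp (hD n x v w)

/-- The Peetre theorem for local functionals. -/
theorem exists_jet_function [T2Space N] [FiniteDimensional ℝ E]
    {F : SmoothFun I N → SmoothFun I N} (hF : IsBastianiSmooth F) (hloc : IsPeetreLocal F)
    (φ : SmoothFun I N) {K : Set N} (hK : IsCompact K) :
    ∃ V ∈ 𝓝 φ, ∃ (p : ℕ) (c : JetBundle I N p → ℝ), IsSmoothOnJets c ∧
      ∀ ψ : SmoothFun I N, φ + ψ ∈ V → ∀ x ∈ K, F (φ + ψ) x = c ⟨x, jet p x ψ⟩ := by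
  have hloc' : IsMultilocal fun φ => toPowOne (F φ) := by
    intro x φ₁ φ₂ h
    exact hloc (x 0) φ₁ φ₂ (eventually_nhdsSet_iff_forall.1 h _ (mem_range_self 0))
  let ι : N → ConfigSpace N 1 := fun x => ⟨fun _ => x, fun _ _ _ => Subsingleton.elim _ _⟩
  have hK' : IsCompact ((fun x (_ : Fin 1) => x) '' K) :=
    hK.image (continuous_pi fun _ => continuous_id)
  obtain ⟨V, hV, p, c, hc, hFc⟩ := exists_multiJet_function hF.toPowOne_comp hloc' φ hK'
  refine ⟨V, hV, p, fun a => c ⟨ι a.1, fun _ => a.2⟩, ?_, fun ψ hψ x hx =>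
    hFc ψ hψ (ι x) (mem_image_of_mem _ hx)⟩
  intro e he
  obtain ⟨g, hg, hcg⟩ := hc (fun _ => e) fun _ => he
  refine ⟨fun q => g (fun _ => q.1, fun _ => q.2), ?_, fun x hx ψ =>
    hcg (ι x) (fun _ => hx) fun _ => ψ⟩
  refine hg.comp (f := fun q : E × JetCoeff E p => ((fun _ => q.1 : Fin 1 → E),
    (fun _ => q.2 : Fin 1 → JetCoeff E p))) ?_ ?_
  · exact ((contDiff_pi.2 fun _ => contDiff_fst).prodMk
      (contDiff_pi.2 fun _ => contDiff_snd)).contDiffOn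
  · exact fun q hq => ⟨fun _ => hq, fun _ _ _ => Subsingleton.elim _ _⟩

end OnePoint

end Peetre
end
theorem mainTheorem3 (d : ℕ) {M : Type*} [TopologicalSpace M] [T2Space M] [ParacompactSpace M]
    [ChartedSpace (EuclideanSpace ℝ (Fin d)) M] [IsManifold (𝓡 d) ∞ M]
    (Ω : TopologicalSpace.Opens M) :
    -- Bastiani smooth `k`-local maps
    (∀ (k : ℕ) (F : Peetre.SmoothFun (𝓡 d) Ω → Peetre.SmoothFunPow (𝓡 d) Ω k),
      Peetre.IsBastianiSmooth F → Peetre.IsMultilocal F →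
      ∀ (φ : Peetre.SmoothFun (𝓡 d) Ω) (K : Set (Fin k → Ω)), IsCompact K →
      ∃ V ∈ 𝓝 φ, ∃ (p : ℕ) (c : Peetre.MultiJetBundle (𝓡 d) Ω p k → ℝ),
        Peetre.IsSmoothOnMultiJets c ∧
        ∀ ψ : Peetre.SmoothFun (𝓡 d) Ω, φ + ψ ∈ V →
          ∀ x : Peetre.ConfigSpace Ω k, x.1 ∈ K →
            F (φ + ψ) x.1 = c ⟨x, fun i => Peetre.jet p (x.1 i) ψ⟩) ∧
    -- Bastiani smooth Peetre local maps
    (∀ F : Peetre.SmoothFun (𝓡 d) Ω → Peetre.SmoothFun (𝓡 d) Ω,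
      Peetre.IsBastianiSmooth F → Peetre.IsPeetreLocal F →
      ∀ (φ : Peetre.SmoothFun (𝓡 d) Ω) (K : Set Ω), IsCompact K →
      ∃ V ∈ 𝓝 φ, ∃ (p : ℕ) (c : Peetre.JetBundle (𝓡 d) Ω p → ℝ),
        Peetre.IsSmoothOnJets c ∧
        ∀ ψ : Peetre.SmoothFun (𝓡 d) Ω, φ + ψ ∈ V →
          ∀ x ∈ K, F (φ + ψ) x = c ⟨x, Peetre.jet p x ψ⟩) := by
  -- Both results are applied to `Ω` as a manifold in its own right, an open submanifold of `M`.
  exact ⟨fun _ _ hF hloc φ _ hK => Peetre.exists_multiJet_function hF hloc φ hK,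
    fun _ hF hloc φ _ hK => Peetre.exists_jet_function hF hloc φ hK⟩
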